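/- Let $p$ be a prime and $r\ge 1$ an integer, and let $Q_{p^r}(n)$ be the number of ordered pairs of commuting $n\times n$ matrices over the finite field $\mathbb{F}_{p^r}$. For $q=p^r$, integers $m\ge 1$ and $n\ge 0$, real $x>0$ and $w\in\mathbb{C}$ with $|w|<1$ not a pole, put $\zeta_m:=e^{2\pi i/m}$ and $$f_{q}(n):=\prod_{j=1}^n\left(1-q^{-j}\right),\qquad P_{m,x}(w):=\prod_{\substack{\ell\ge1\\ \ell\ne m}}\frac1{1-xw^\ell},\qquad F_{q}(w):=\prod_{\ell,j\ge1}\frac1{1-q^{1-j}w^\ell},$$ $$C_{m,q}(n):=\frac1m\sum_{j=0}^{m-1}P_{m,q}\left(\zeta_m^{-j}p^{-\frac rm}\right)F_{q}\left(\zeta_m^{-j}p^{-\frac rm}\right)\zeta_m^{nj}.$$ For all $m\ge1$ and $0\le j<m$, the point $\zeta_m^{-j}p^{-r/m}$ lies in the open unit disc, no factor of the two products has a vanishing denominator there, and both products converge there. As $n\to\infty$, there is the asymptotic expansion $$Q_{p^r}(n)\sim p^{rn^2}f_{p^r}(n)\sum_{m\ge1}C_{m,p^r}(n)\,p^{\frac{rn}m},$$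 that is, for every integer $N\ge0$, $$Q_{p^r}(n)=p^{rn^2}f_{p^r}(n)\left(\sum_{m=1}^N C_{m,p^r}(n)\,p^{\frac{rn}m}+O\left(p^{\frac{rn}{N+1}}\right)\right)\qquad(n\to\infty),$$ and, for every integer $N\ge 0$ and every $\varepsilon>0$, $$Q_{p^r}(n)=p^{rn^2}f_{p^r}(n)\sum_{m=1}^N C_{m,p^r}(n)\,p^{\frac{rn}m}+O_\varepsilon\left(p^{rn^2+\left(\frac r{N+1}+\varepsilon\right)n}\right)\qquad(n\to\infty).$$ The implied constants may depend on $p$, $r$, $N$ (and, in the last estimate, on $\varepsilon$). In particular, the product below converges and, as $n\to\infty$, $$Q_{p^r}(n)=p^{r(n^2+n)}\prod_{j\ge1}\left(1-p^{-rj}\right)^{-j}+O\left(p^{rn^2+\frac{rn}2}\right).$$ -/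

import Mathlib

open Filter Asymptotics

noncomputable section

namespace CommutingPairs

/-- The number of ordered pairs of commuting `n × n` matrices over the field with `p ^ r`
elements. -/
def Q (p : ℕ) [Fact p.Prime] (r n : ℕ) : ℕ :=
  Nat.card {X : Matrix (Fin n) (Fin n) (GaloisField p r) ×
    Matrix (Fin n) (Fin n) (GaloisField p r) // X.1 * X.2 = X.2 * X.1}

/-- `f q n = ∏_{j=1}^n (1 - q^{-j})`. -/
def f (q : ℝ) (n : ℕ) : ℝ :=
  ∏ j ∈ Finset.Icc 1 n, (1 - q ^ (-(j : ℤ)))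

/-- `P m x w = ∏_{ℓ ≥ 1, ℓ ≠ m} 1 / (1 - x w^ℓ)`. -/
def P (m : ℕ) (x : ℝ) (w : ℂ) : ℂ :=
  ∏' l : {l : ℕ // 1 ≤ l ∧ l ≠ m}, 1 / (1 - (x : ℂ) * w ^ (l : ℕ))

/-- `F q w = ∏_{ℓ, j ≥ 1} 1 / (1 - q^{1-j} w^ℓ)`, a product over all pairs `(ℓ, j)`. -/
def F (q : ℝ) (w : ℂ) : ℂ :=
  ∏' k : ℕ+ × ℕ+, 1 / (1 - (q : ℂ) ^ (1 - ((k.2 : ℕ) : ℤ)) * w ^ (k.1 : ℕ))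

/-- The root of unity `ζ_m = e^{2πi/m}`. -/
def zeta (m : ℕ) : ℂ :=
  Complex.exp (2 * Real.pi * Complex.I / m)

/-- The point `ζ_m^{-j} p^{-r/m}`. -/
def point (p r m j : ℕ) : ℂ :=
  zeta m ^ (-(j : ℤ)) * (((p : ℝ) ^ (-((r : ℝ) / m)) : ℝ) : ℂ)

/-- The coefficient
`C_{m,p^r}(n) = (1/m) ∑_{j=0}^{m-1} P_{m,p^r}(ζ_m^{-j} p^{-r/m}) F_{p^r}(ζ_m^{-j} p^{-r/m}) ζ_m^{nj}`. -/
def C (p r m n : ℕ) : ℂ :=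
  1 / (m : ℂ) * ∑ j ∈ Finset.range m,
    P m ((p : ℝ) ^ r) (point p r m j) * F ((p : ℝ) ^ r) (point p r m j) * zeta m ^ (n * j)

/-- The expansion truncated after `m = N`, namely
`p^{r n^2} f_{p^r}(n) ∑_{m=1}^N C_{m,p^r}(n) p^{r n / m}`. -/
def truncated (p r N n : ℕ) : ℂ :=
  (p : ℂ) ^ (r * n ^ 2) * (f ((p : ℝ) ^ r) n : ℂ) *
    ∑ m ∈ Finset.Icc 1 N, C p r m n * (((p : ℝ) ^ ((r : ℝ) * n / m) : ℝ) : ℂ)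

end CommutingPairs

end

/-! Commuting pairs `(X, Y)` are sorted by the corank `k` of `X`. Write the space as `W × U` with
`dim U = k` and `X = i ∘ s` with `i : W → V` injective and `s` surjective. After a conjugation `i`
is the inclusion of `W`; then `Y` is block triangular, and the pair restricts to a commuting pair on
`W`, with `X` restricting to some corank `j`. Given that restriction, the other blocks are counted
by linear algebra, with an answer depending only on the dimensions and `j`. Divided by orders of
general linear groups this is the recursion `pairDensity_add`: `a(n + k, k) = ∑_{j ≤ k} a(n, j) /
f(k - j)`.

In corank 0, Burnside's lemma turns `a(n, 0)` into the number of similarity classes of `n × n`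
matrices. Classes are multisets of powers of monic irreducibles, and unique factorization in `K[X]`
gives their series `∏_{e ≥ 1} 1 / (1 - q x^e)`.

For `B(x, y) = ∑ a(n, k) x^n y^k` and `E(t) = ∑ t^m / f(m)`, the recursion says `B(x, x^j) = B(x,
x^(j+1)) E(x^(j+1))`. Iterating, with Euler's `E(t) = ∏_{j ≥ 0} 1 / (1 - q^(-j) t)`, expresses `B(x,
1)`, the series of `Q / |GL_n|`, as the double product of Feit and Fine (`hasSum_totalDensity`).

In the unit disc this product has only simple poles, at the solutions of `q w^m = 1`, which lie on
circles whose radii increase with `m`. Removing the principal parts up to `m = M` leaves a function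
holomorphic beyond the `M`-th circle, and its Taylor coefficients are the error
(`coeff_isBigO_of_simple_poles`). The values of the remaining factors at the poles give `C_m`. For
`m = 1` the constant `C_1` cancels the limit of `f` up to the stated product (`C_one`,
`abs_f_mul_tprod_sub_one_le`). -/

noncomputable section

namespace CommutingPairs

set_option linter.unusedSectionVars false

open Module

/-! ### Counting linear maps over a finite field -/

section Counting

variable {K : Type*} [Field K] [Finite K]
variable {V : Type*} [AddCommGroup V] [Module K V] [Module.Finite K V]
variable {W : Type*} [AddCommGroup W] [Module K W] [Module.Finite K W]
variable {U : Type*} [AddCommGroup U] [Module K U] [Module.Finite K U]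

/-- The number of linearly independent `m`-tuples in an `n`-dimensional space over a field with `q`
elements. -/
def indepCount (q n m : ℕ) : ℕ := ∏ i : Fin m, (q ^ n - q ^ (i : ℕ))

theorem linearIndependent_basis_comp_iff {ι : Type*} (b : Basis ι K V) (f : V →ₗ[K] W) :
    LinearIndependent K (f ∘ b) ↔ Function.Injective f := by
  constructor
  · intro h
    have h2 : f = (Finsupp.linearCombination K (f ∘ b)) ∘ₗ b.repr.toLinearMap :=
      b.ext fun i => by simp
    rw [h2]
    exact Function.Injective.comp (g := Finsupp.linearCombination K (f ∘ b)) h b.repr.injective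
  · intro h
    exact b.linearIndependent.map' f (LinearMap.ker_eq_bot.2 h)

/-- The factor with `i = n` vanishes, so the truncated subtraction in later factors is harmless. -/
theorem indepCount_eq_zero {q n m : ℕ} (h : n < m) : indepCount q n m = 0 :=
  Finset.prod_eq_zero (Finset.mem_univ ⟨n, h⟩) (by simp)

theorem card_injective :
    Nat.card {f : V →ₗ[K] W // Function.Injective f} =
      indepCount (Nat.card K) (finrank K W) (finrank K V) := by
  rcases lt_or_ge (finrank K W) (finrank K V) with h | h
  · rw [indepCount_eq_zero h, Nat.card_eq_zero]
    exact .inl ⟨fun f => absurd (LinearMap.finrank_le_finrank_of_injective f.2) (by omega)⟩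
  have : Finite W := Module.finite_of_finite K
  have := Fintype.ofFinite K
  rw [indepCount, Nat.card_eq_fintype_card (α := K), ← card_linearIndependent h]
  refine Nat.card_congr (((finBasis K V).constr K).symm.toEquiv.subtypeEquiv fun f => ?_)
  rw [← linearIndependent_basis_comp_iff (finBasis K V)]
  rfl

/-- Transposition is injective because functionals separate points, and both sides have the same
finite cardinality. It reduces counting surjections to counting injections. -/
theorem dualMap_bijective :
    Function.Bijective (fun f : V →ₗ[K] W => f.dualMap) := by
  have h1 : Finite (V →ₗ[K] W) := Module.finite_of_finite K
  have h2 : Finite (Dual K W →ₗ[K] Dual K V) := Module.finite_of_finite K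
  refine (Nat.bijective_iff_injective_and_card _).2 ⟨fun f g h => ?_, ?_⟩
  · ext v
    refine (Module.forall_dual_apply_eq_zero_iff K _).1 ?_ |> sub_eq_zero.1
    intro φ
    have := LinearMap.congr_fun (LinearMap.congr_fun h φ) v
    simpa [sub_eq_zero] using this
  · rw [natCard_eq_pow_finrank (K := K) (V := V →ₗ[K] W),
      natCard_eq_pow_finrank (K := K) (V := Dual K W →ₗ[K] Dual K V), finrank_linearMap,
      finrank_linearMap, Subspace.dual_finrank_eq, Subspace.dual_finrank_eq, mul_comm]

theorem card_surjective :
    Nat.card {f : V →ₗ[K] W // Function.Surjective f} =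
      indepCount (Nat.card K) (finrank K V) (finrank K W) := by
  rw [← Subspace.dual_finrank_eq (K := K) (V := V), ← Subspace.dual_finrank_eq (K := K) (V := W)]
  rw [← card_injective]
  refine Nat.card_congr ((Equiv.ofBijective _ dualMap_bijective).subtypeEquiv fun f => ?_)
  simp

theorem card_linearEquiv : Nat.card (V ≃ₗ[K] V) =
    indepCount (Nat.card K) (finrank K V) (finrank K V) := by
  rw [← card_injective]
  refine Nat.card_congr ⟨fun e => ⟨e.toLinearMap, e.injective⟩,
    fun f => LinearEquiv.ofInjectiveEndo f.1 f.2, fun e => ?_, fun f => ?_⟩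
  · ext; rfl
  · ext; rfl

theorem card_fiber {L : V →ₗ[K] W} (hL : Function.Surjective L) (w : W) :
    Nat.card {v // L v = w} = Nat.card K ^ (finrank K V - finrank K W) := by
  obtain ⟨v₀, rfl⟩ := hL w
  have h1 := L.finrank_range_add_finrank_ker
  rw [LinearMap.range_eq_top.2 hL, finrank_top] at h1
  rw [show finrank K V - finrank K W = finrank K L.ker by omega,
    ← natCard_eq_pow_finrank (K := K)]
  refine Nat.card_congr ((Equiv.subRight v₀).subtypeEquiv fun v => ?_)
  simp [sub_eq_zero]

/-- Extensions of an endomorphism of `W` to a surjection from `W × U`. -/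
theorem card_sup_range_eq_top (X : W →ₗ[K] W) {j : ℕ}
    (hj : finrank K X.range + j = finrank K W) :
    Nat.card {S : U →ₗ[K] W // X.range ⊔ S.range = ⊤} =
      Nat.card K ^ (finrank K U * (finrank K W - j)) *
        indepCount (Nat.card K) (finrank K U) j := by
  have hfin : finrank K (W ⧸ X.range) = j := by
    have := X.range.finrank_quotient_add_finrank
    omega
  have : Finite (U →ₗ[K] W ⧸ X.range) := Module.finite_of_finite K
  have : Finite (U →ₗ[K] W) := Module.finite_of_finite K
  -- The condition on `S` says exactly that its composite with the projection to `W ⧸ X.range` is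
  -- surjective. So the count is the number of surjections onto a space of dimension `j`, times the
  -- common size of the fibres of `L`.
  let L : (U →ₗ[K] W) →ₗ[K] (U →ₗ[K] W ⧸ X.range) := LinearMap.compRight K X.range.mkQ
  have hL : Function.Surjective L := by
    obtain ⟨s, hs⟩ := X.range.mkQ.exists_rightInverse_of_surjective (by simp)
    intro g
    refine ⟨s ∘ₗ g, ?_⟩
    change X.range.mkQ ∘ₗ (s ∘ₗ g) = g
    rw [← LinearMap.comp_assoc, hs, LinearMap.id_comp]
  have key (S : U →ₗ[K] W) : X.range ⊔ S.range = ⊤ ↔ Function.Surjective (L S) := by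
    have h2 : (L S).range = S.range.map X.range.mkQ := LinearMap.range_comp _ _
    rw [← LinearMap.range_eq_top, h2]
    rw [Submodule.map_mkQ_eq_top]
  let e : {S : U →ₗ[K] W // X.range ⊔ S.range = ⊤} ≃
      Σ T : {T : U →ₗ[K] W ⧸ X.range // Function.Surjective T}, {S // L S = T} :=
    { toFun := fun S => ⟨⟨L S.1, (key _).1 S.2⟩, S.1, rfl⟩
      invFun := fun x => ⟨x.2.1, (key _).2 (by rw [x.2.2]; exact x.1.2)⟩
      left_inv := fun S => rfl
      right_inv := by
        rintro ⟨⟨T, hT⟩, ⟨S, hS⟩⟩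
        obtain rfl : L S = T := hS
        rfl }
  have := Fintype.ofFinite {T : U →ₗ[K] W ⧸ X.range // Function.Surjective T}
  rw [Nat.card_congr e, Nat.card_sigma]
  simp_rw [card_fiber hL]
  rw [Finset.sum_const, Finset.card_univ, ← Nat.card_eq_fintype_card,
    card_surjective, hfin, smul_eq_mul, mul_comm, finrank_linearMap,
    finrank_linearMap, hfin, Nat.mul_sub]

end Counting

/-! ### The recursion on the corank -/

section Corank

variable {K : Type*} [Field K] [Finite K]
variable {V : Type*} [AddCommGroup V] [Module K V] [Module.Finite K V]
variable {W : Type*} [AddCommGroup W] [Module K W] [Module.Finite K W]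
variable {U : Type*} [AddCommGroup U] [Module K U] [Module.Finite K U]

variable (K V) in
/-- The number of pairs `(X, Y)` of commuting endomorphisms with `X` of corank `k`. -/
def corankCount (k : ℕ) : ℕ :=
  Nat.card {p : End K V × End K V // p.1 * p.2 = p.2 * p.1 ∧ finrank K p.1.range + k = finrank K V}

theorem card_subtype_prod {α β : Type*} [Fintype α] [Finite β] (p : α → β → Prop) :
    Nat.card {x : α × β // p x.1 x.2} = ∑ a, Nat.card {b // p a b} := by
  rw [← Nat.card_sigma]
  exact Nat.card_congr (Equiv.subtypeProdEquivSigmaSubtype p)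

theorem card_subtype_eq_mul {α β : Type*} [Finite α] [Finite β] {p : α → Prop} {r : β → Prop}
    (φ : α → β) (hφ : ∀ a, p a → r (φ a)) {c : ℕ}
    (h : ∀ b, r b → Nat.card {a // p a ∧ φ a = b} = c) :
    Nat.card {a // p a} = Nat.card {b // r b} * c := by
  have := Fintype.ofFinite {b // r b}
  let ψ : {a // p a} → {b // r b} := fun a => ⟨φ a, hφ a a.2⟩
  have h1 (b : {b // r b}) : Nat.card {a // ψ a = b} = c := by
    rw [← h b b.2]
    refine Nat.card_congr ((Equiv.subtypeEquivRight fun a => Subtype.ext_iff).trans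
      (Equiv.subtypeSubtypeEquivSubtypeInter p fun a => φ a = b))
  rw [Nat.card_congr (Equiv.sigmaFiberEquiv ψ).symm, Nat.card_sigma, Finset.sum_congr rfl
    fun b _ => h1 b, Finset.sum_const, Finset.card_univ, Nat.card_eq_fintype_card, smul_eq_mul]

/-- Factorizations of `X` through a space of dimension the rank of `X`. -/
theorem card_factorizations (X : End K V) (hX : finrank K X.range = finrank K W) :
    Nat.card {t : (W →ₗ[K] V) × (V →ₗ[K] W) //
      Function.Injective t.1 ∧ Function.Surjective t.2 ∧ t.1 ∘ₗ t.2 = X} =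
      indepCount (Nat.card K) (finrank K W) (finrank K W) := by
  rw [← card_linearEquiv (V := W)]
  have e₀ : W ≃ₗ[K] X.range := LinearEquiv.ofFinrankEq _ _ hX.symm
  symm
  -- The automorphisms of `W` act simply transitively on the factorizations; the base point is `e₀`,
  -- which identifies `W` with the range of `X`.
  refine Nat.card_eq_of_bijective (fun g : W ≃ₗ[K] W =>
    ⟨(X.range.subtype ∘ₗ e₀.toLinearMap ∘ₗ g.toLinearMap,
      g.symm.toLinearMap ∘ₗ e₀.symm.toLinearMap ∘ₗ X.rangeRestrict), ?_, ?_, ?_⟩) ⟨?_, ?_⟩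
  · exact X.range.injective_subtype.comp (e₀.injective.comp g.injective)
  · exact g.symm.surjective.comp (e₀.symm.surjective.comp X.surjective_rangeRestrict)
  · ext v
    simp
  · intro g g' h
    ext w
    have := LinearMap.congr_fun (congrArg (fun t => t.1.1) h) w
    simpa using this
  · rintro ⟨⟨i, s⟩, hi, hs, h⟩
    dsimp only at hi hs h
    have hmem (w : W) : i w ∈ X.range := by
      obtain ⟨v, rfl⟩ := hs w
      exact ⟨v, by rw [← h]; rfl⟩
    let i' : W →ₗ[K] X.range := i.codRestrict X.range hmem
    have hg : Function.Injective (e₀.symm.toLinearMap ∘ₗ i') :=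
      e₀.symm.injective.comp fun a b hab => hi (congrArg Subtype.val hab)
    let g := LinearEquiv.ofInjectiveEndo _ hg
    have hgw (w : W) : e₀ (g w) = i' w := by
      simp [g]
    refine ⟨g, ?_⟩
    have h1 : X.range.subtype ∘ₗ e₀.toLinearMap ∘ₗ g.toLinearMap = i := by
      ext w
      simp [hgw, i']
    refine Subtype.ext (Prod.ext h1 ?_)
    ext v
    apply hi
    change _ = (i ∘ₗ s) v
    rw [h, ← h1]
    simp

/-- Any complement of the range of `i` has the dimension of `U`. Conjugation by such a `g` reduces a
general `i` to the standard inclusion. -/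
theorem exists_linearEquiv_inl (i : W →ₗ[K] W × U) (hi : Function.Injective i) :
    ∃ g : (W × U) ≃ₗ[K] W × U, ∀ w, g (w, 0) = i w := by
  obtain ⟨C, hC⟩ := i.range.exists_isCompl
  have h1 := LinearMap.finrank_range_of_inj hi
  have h2 := Submodule.finrank_add_eq_of_isCompl hC
  rw [finrank_prod] at h2
  let e : U ≃ₗ[K] C := LinearEquiv.ofFinrankEq _ _ (by omega)
  refine ⟨((LinearEquiv.ofInjective i hi).prodCongr e).trans (Submodule.prodEquivOfIsCompl _ _ hC),
    fun w => ?_⟩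
  simp

/-- The equivalence describing the endomorphisms of `W × U` commuting with one of range in `W`. -/
def blockEquiv :
    {t : (W × U →ₗ[K] W) × End K (W × U) // Function.Surjective t.1 ∧
      (LinearMap.inl K W U ∘ₗ t.1) * t.2 = t.2 * (LinearMap.inl K W U ∘ₗ t.1)} ≃
    {z : ((End K W × End K W) × (U →ₗ[K] W)) × ((U →ₗ[K] W) × End K U) //
      (z.1.1.1 * z.1.1.2 = z.1.1.2 * z.1.1.1 ∧ z.1.1.1.range ⊔ z.1.2.range = ⊤) ∧
      z.1.1.1 ∘ₗ z.2.1 + z.1.2 ∘ₗ z.2.2 = z.1.1.2 ∘ₗ z.1.2} where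
  toFun t := ⟨(((t.1.1 ∘ₗ LinearMap.inl K W U,
      LinearMap.fst K W U ∘ₗ t.1.2 ∘ₗ LinearMap.inl K W U), t.1.1 ∘ₗ LinearMap.inr K W U),
      (LinearMap.fst K W U ∘ₗ t.1.2 ∘ₗ LinearMap.inr K W U,
        LinearMap.snd K W U ∘ₗ t.1.2 ∘ₗ LinearMap.inr K W U)), by
    obtain ⟨⟨s, Y⟩, hs, h⟩ := t
    dsimp only at hs h ⊢
    have h' (v) : (s (Y v), (0 : U)) = Y (s v, 0) := LinearMap.congr_fun h v
    -- `Y` preserves the range of the endomorphism it commutes with, which is `W × 0` as `s` is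
    -- surjective; hence the lower left block vanishes.
    have hY (w : W) : (Y (w, 0)).2 = 0 := by
      obtain ⟨v, rfl⟩ := hs w
      rw [← h']
    have hsplit (v : W × U) : s v = s (v.1, 0) + s (0, v.2) := by
      rw [← map_add]; simp
    refine ⟨⟨?_, ?_⟩, ?_⟩
    · ext w
      have := congrArg Prod.fst (h' (w, 0))
      rw [hsplit (Y (w, 0)), hY, show ((0 : W), (0 : U)) = 0 from rfl, map_zero, add_zero] at this
      exact this
    · rw [← LinearMap.range_coprod, LinearMap.range_eq_top]
      convert hs
      ext <;> simp
    · ext u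
      have := congrArg Prod.fst (h' (0, u))
      rw [hsplit (Y (0, u))] at this
      exact this⟩
  invFun z := ⟨(z.1.1.1.1.coprod z.1.1.2,
      (z.1.1.1.2.coprod z.1.2.1).prod ((0 : W →ₗ[K] U).coprod z.1.2.2)), by
    obtain ⟨⟨⟨⟨X, Y⟩, S⟩, T, Z⟩, ⟨h1, h2⟩, h3⟩ := z
    dsimp only at h1 h2 h3 ⊢
    refine ⟨?_, ?_⟩
    · rw [← LinearMap.range_eq_top, LinearMap.range_coprod, h2]
    · ext v
      · simpa using LinearMap.congr_fun h1 v
      · simp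
      · simpa using LinearMap.congr_fun h3 v
      · simp⟩
  left_inv t := by
    obtain ⟨⟨s, Y⟩, hs, h⟩ := t
    have h' (v) : (s (Y v), (0 : U)) = Y (s v, 0) := LinearMap.congr_fun h v
    have hY (w : W) : (Y (w, 0)).2 = 0 := by
      obtain ⟨v, rfl⟩ := hs w
      rw [← h']
    have h0 : Y (0, 0) = 0 := map_zero Y
    refine Subtype.ext (Prod.ext ?_ ?_)
    · ext <;> simp
    · ext v <;> simp [h0, hY]
  right_inv z := by
    obtain ⟨⟨⟨⟨X, Y⟩, S⟩, T, Z⟩, ⟨h1, h2⟩, h3⟩ := z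
    refine Subtype.ext (Prod.ext (Prod.ext (Prod.ext ?_ ?_) ?_) (Prod.ext ?_ ?_)) <;> ext v <;> simp

theorem card_subtype_prod_and {α β : Type*} [Fintype α] [Finite β] (p : α → Prop) [DecidablePred p]
    (r : α → β → Prop) :
    Nat.card {x : α × β // p x.1 ∧ r x.1 x.2} =
      ∑ a, if p a then Nat.card {b // r a b} else 0 := by
  rw [card_subtype_prod (fun a b => p a ∧ r a b)]
  refine Finset.sum_congr rfl fun a _ => ?_
  split_ifs with h <;> simp [h]

theorem card_subtype_eq_sum {α : Type*} [Fintype α] (p : α → Prop) [DecidablePred p] :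
    Nat.card {a // p a} = ∑ a, if p a then 1 else 0 := by
  rw [Nat.card_eq_fintype_card, Fintype.card_subtype, Finset.card_filter]

/-- For fixed commuting `(X, Y)` on `W` and fixed `S`, the blocks `(T, Z)` solve the linear equation
`X T + S Z = Y S`. Its left side is onto because the ranges of `X` and `S` span `W`, so there are
always `q ^ (dim U)²` solutions. The number of admissible `S` depends only on the corank `j` of `X`.
-/
theorem card_block :
    Nat.card {t : (W × U →ₗ[K] W) × End K (W × U) // Function.Surjective t.1 ∧
      (LinearMap.inl K W U ∘ₗ t.1) * t.2 = t.2 * (LinearMap.inl K W U ∘ₗ t.1)} =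
    ∑ j ∈ Finset.range (finrank K W + 1), corankCount K W j *
      (Nat.card K ^ (finrank K U * (finrank K W - j)) * indepCount (Nat.card K) (finrank K U) j *
        Nat.card K ^ (finrank K U * finrank K U)) := by
  classical
  have : Finite (End K W) := Module.finite_of_finite K
  have : Finite (End K U) := Module.finite_of_finite K
  have : Finite (U →ₗ[K] W) := Module.finite_of_finite K
  have := Fintype.ofFinite (End K W)
  have := Fintype.ofFinite (U →ₗ[K] W)
  rw [Nat.card_congr blockEquiv, card_subtype_prod_and
    (fun a : (End K W × End K W) × (U →ₗ[K] W) => a.1.1 * a.1.2 = a.1.2 * a.1.1 ∧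
      a.1.1.range ⊔ a.2.range = ⊤)
    (fun a (b : (U →ₗ[K] W) × End K U) => a.1.1 ∘ₗ b.1 + a.2 ∘ₗ b.2 = a.1.2 ∘ₗ a.2)]
  have h1 (a : (End K W × End K W) × (U →ₗ[K] W)) (ha : a.1.1.range ⊔ a.2.range = ⊤) :
      Nat.card {b : (U →ₗ[K] W) × End K U // a.1.1 ∘ₗ b.1 + a.2 ∘ₗ b.2 = a.1.2 ∘ₗ a.2} =
        Nat.card K ^ (finrank K U * finrank K U) := by
    let L : ((U →ₗ[K] W) × End K U) →ₗ[K] (U →ₗ[K] W) :=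
      (LinearMap.compRight K a.1.1).coprod (LinearMap.compRight K a.2)
    have hL : Function.Surjective L := by
      -- A section of the row `(X, S) : W × U → W` lifts every `g : U → W`.
      obtain ⟨s, hs⟩ := (a.1.1.coprod a.2).exists_rightInverse_of_surjective
        (by rw [LinearMap.range_coprod, ha])
      intro g
      refine ⟨(LinearMap.fst K W U ∘ₗ s ∘ₗ g, LinearMap.snd K W U ∘ₗ s ∘ₗ g), ?_⟩
      ext u
      have := LinearMap.congr_fun hs (g u)
      simpa [L] using this
    have h2 := card_fiber hL (a.1.2 ∘ₗ a.2)
    rw [finrank_prod, finrank_linearMap, finrank_linearMap, Nat.add_sub_cancel_left] at h2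
    exact h2
  rw [Finset.sum_congr rfl (g := fun a => (if a.1.1 * a.1.2 = a.1.2 * a.1.1 ∧
      a.1.1.range ⊔ a.2.range = ⊤ then 1 else 0) * Nat.card K ^ (finrank K U * finrank K U))
    (fun a _ => by
      split_ifs with h
      · rw [h1 a h.2, one_mul]
      · rw [zero_mul])]
  rw [← Finset.sum_mul, ← card_subtype_eq_sum, card_subtype_prod_and
    (fun a : End K W × End K W => a.1 * a.2 = a.2 * a.1)
    (fun a (S : U →ₗ[K] W) => a.1.range ⊔ S.range = ⊤)]
  have h3 (a : End K W × End K W) :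
      (if a.1 * a.2 = a.2 * a.1 then Nat.card {S : U →ₗ[K] W // a.1.range ⊔ S.range = ⊤} else 0) =
      ∑ j ∈ Finset.range (finrank K W + 1),
        (if a.1 * a.2 = a.2 * a.1 ∧ finrank K a.1.range + j = finrank K W then 1 else 0) *
        (Nat.card K ^ (finrank K U * (finrank K W - j)) *
          indepCount (Nat.card K) (finrank K U) j) := by
    have hle := Submodule.finrank_le a.1.range
    rw [Finset.sum_eq_single (finrank K W - finrank K a.1.range)]
    · have h4 : finrank K a.1.range + (finrank K W - finrank K a.1.range) = finrank K W := by omega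
      rw [card_sup_range_eq_top a.1 h4]
      simp [h4]
    · intro j _ hj
      rw [if_neg (by omega), zero_mul]
    · intro h
      simp only [Finset.mem_range] at h
      omega
  rw [Finset.sum_congr rfl fun a _ => h3 a, Finset.sum_comm, Finset.sum_mul]
  refine Finset.sum_congr rfl fun j _ => ?_
  rw [← Finset.sum_mul, ← card_subtype_eq_sum, mul_assoc]
  rfl

/-- Double count of triples `(i, s, Y)` such that `Y` commutes with `i ∘ s`. Remembering only `(i ∘
s, Y)` gives the left side, since each `X` of the right rank has `|GL(W)|` factorizations.
Remembering only `i` gives the right side, since conjugation makes every fibre equinumerous with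
that of `LinearMap.inl`. -/
theorem corankCount_mul_indepCount :
    corankCount K (W × U) (finrank K U) *
      indepCount (Nat.card K) (finrank K W) (finrank K W) =
    indepCount (Nat.card K) (finrank K W + finrank K U) (finrank K W) *
      ∑ j ∈ Finset.range (finrank K W + 1), corankCount K W j *
        (Nat.card K ^ (finrank K U * (finrank K W - j)) *
          indepCount (Nat.card K) (finrank K U) j * Nat.card K ^ (finrank K U * finrank K U)) := by
  rw [← card_block, ← finrank_prod, ← card_injective (V := W) (W := W × U)]
  have : Finite (End K (W × U)) := Module.finite_of_finite K
  have : Finite (W →ₗ[K] W × U) := Module.finite_of_finite K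
  have : Finite (W × U →ₗ[K] W) := Module.finite_of_finite K
  let T (t : ((W →ₗ[K] W × U) × (W × U →ₗ[K] W)) × End K (W × U)) : Prop :=
    (Function.Injective t.1.1 ∧ Function.Surjective t.1.2) ∧
      (t.1.1 ∘ₗ t.1.2) * t.2 = t.2 * (t.1.1 ∘ₗ t.1.2)
  have hrank (t : (W →ₗ[K] W × U) × (W × U →ₗ[K] W)) (h1 : Function.Injective t.1)
      (h2 : Function.Surjective t.2) : finrank K (t.1 ∘ₗ t.2).range = finrank K W := by
    rw [LinearMap.range_comp, LinearMap.range_eq_top.2 h2, Submodule.map_top,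
      LinearMap.finrank_range_of_inj h1]
  trans Nat.card {t // T t}
  · symm
    refine card_subtype_eq_mul (fun t => (t.1.1 ∘ₗ t.1.2, t.2)) (fun t ht => ⟨ht.2, ?hr⟩) ?_
    case hr => rw [hrank _ ht.1.1 ht.1.2, finrank_prod]
    rintro ⟨X, Y⟩ ⟨hXY, hX⟩
    rw [finrank_prod, Nat.add_right_cancel_iff] at hX
    rw [← card_factorizations X hX]
    refine Nat.card_congr ⟨fun t => ⟨t.1.1, t.2.1.1.1, t.2.1.1.2, (Prod.ext_iff.1 t.2.2).1⟩,
      fun t => ⟨(t.1, Y), ⟨⟨t.2.1, t.2.2.1⟩, by rw [t.2.2.2]; exact hXY⟩,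
        Prod.ext t.2.2.2 rfl⟩, fun t => ?_, fun t => rfl⟩
    exact Subtype.ext (Prod.ext rfl (Prod.ext_iff.1 t.2.2).2.symm)
  · refine card_subtype_eq_mul (fun t => t.1.1) (fun t ht => ht.1.1) ?_
    rintro i hi
    obtain ⟨g, hg⟩ := exists_linearEquiv_inl i hi
    have hg' (w : W) : g.symm (i w) = (w, 0) := by rw [← hg, g.symm_apply_apply]
    refine Nat.card_congr ⟨fun t => ⟨(t.1.1.2 ∘ₗ g.toLinearMap,
        g.symm.toLinearMap ∘ₗ t.1.2 ∘ₗ g.toLinearMap), t.2.1.1.2.comp g.surjective, ?_⟩,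
      fun t => ⟨((i, t.1.1 ∘ₗ g.symm.toLinearMap),
        g.toLinearMap ∘ₗ t.1.2 ∘ₗ g.symm.toLinearMap), ⟨⟨hi, t.2.1.comp g.symm.surjective⟩, ?_⟩,
        rfl⟩, fun t => ?_, fun t => ?_⟩
    · obtain ⟨⟨⟨i', s⟩, Y⟩, ⟨⟨h1, h2⟩, h3⟩, h4⟩ := t
      obtain rfl : i' = i := h4
      refine LinearMap.ext fun v => ?_
      have h5 := LinearMap.congr_fun h3 (g v)
      change i' (s (Y (g v))) = Y (i' (s (g v))) at h5
      change (s (g (g.symm (Y (g v)))), (0 : U)) = g.symm (Y (g (s (g v), 0)))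
      rw [g.apply_symm_apply, hg, ← h5, hg']
    · obtain ⟨⟨s, Y⟩, h1, h2⟩ := t
      refine LinearMap.ext fun v => ?_
      have h5 := LinearMap.congr_fun h2 (g.symm v)
      change (s (Y (g.symm v)), (0 : U)) = Y (s (g.symm v), 0) at h5
      change i (s (g.symm (g (Y (g.symm v))))) = g (Y (g.symm (i (s (g.symm v)))))
      rw [g.symm_apply_apply, hg', ← h5, hg]
    · obtain ⟨⟨⟨i', s⟩, Y⟩, ⟨⟨h1, h2⟩, h3⟩, h4⟩ := t
      obtain rfl : i' = i := h4
      refine Subtype.ext (Prod.ext (Prod.ext rfl ?_) ?_) <;>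
        refine LinearMap.ext fun v => ?_ <;> simp
    · refine Subtype.ext (Prod.ext ?_ ?_) <;> refine LinearMap.ext fun v => ?_ <;> simp

end Corank

/-! ### Normalization by the order of the general linear group -/

section Density

variable {K : Type*} [Field K] [Finite K]
variable {V : Type*} [AddCommGroup V] [Module K V] [Module.Finite K V]
variable {W : Type*} [AddCommGroup W] [Module K W] [Module.Finite K W]

theorem corankCount_congr (e : V ≃ₗ[K] W) (k : ℕ) : corankCount K V k = corankCount K W k := by
  refine Nat.card_congr ((e.conjAlgEquiv K).toEquiv.prodCongr
    (e.conjAlgEquiv K).toEquiv |>.subtypeEquiv fun p => ?_)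
  have h1 : finrank K (e.conjAlgEquiv K p.1).range = finrank K p.1.range := by
    have : e.conjAlgEquiv K p.1 = e.toLinearMap ∘ₗ p.1 ∘ₗ e.symm.toLinearMap := by
      ext; simp [LinearEquiv.conjAlgEquiv_apply]
    rw [this, LinearMap.range_comp, LinearMap.range_comp, LinearEquiv.range, Submodule.map_top]
    exact LinearEquiv.finrank_map_eq e _
  change _ ↔ e.conjAlgEquiv K p.1 * e.conjAlgEquiv K p.2 =
    e.conjAlgEquiv K p.2 * e.conjAlgEquiv K p.1 ∧ finrank K (e.conjAlgEquiv K p.1).range + k = _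
  rw [h1, ← map_mul, ← map_mul, (e.conjAlgEquiv K).injective.eq_iff, e.finrank_eq]

theorem corankCount_eq_zero {k : ℕ} (h : finrank K V < k) : corankCount K V k = 0 := by
  rw [corankCount, Nat.card_eq_zero]
  exact .inl ⟨fun p => by have := p.2.2; omega⟩

theorem f_pos {q : ℝ} (hq : 1 < q) (n : ℕ) : 0 < f q n := by
  refine Finset.prod_pos fun j hj => sub_pos.2 ?_
  rw [zpow_neg, zpow_natCast]
  exact inv_lt_one_of_one_lt₀ (one_lt_pow₀ hq (by have := (Finset.mem_Icc.1 hj).1; omega))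

theorem f_succ (q : ℝ) (n : ℕ) : f q (n + 1) = f q n * (1 - (q ^ (n + 1))⁻¹) := by
  rw [f, Finset.prod_Icc_succ_top (by omega), f, zpow_neg, zpow_natCast]

theorem indepCount_succ (q n m : ℕ) :
    indepCount q n (m + 1) = indepCount q n m * (q ^ n - q ^ m) := by
  simp [indepCount, Fin.prod_univ_castSucc]

theorem indepCount_mul_f {q : ℕ} (hq : 1 < q) {n m : ℕ} (h : m ≤ n) :
    (indepCount q n m : ℝ) * f q (n - m) = (q : ℝ) ^ (n * m) * f q n := by
  induction m with
  | zero => simp [indepCount]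
  | succ m ih =>
    have hq0 : (0 : ℝ) < q := by positivity
    have h1 : f q (n - m) = f q (n - (m + 1)) * (1 - ((q : ℝ) ^ (n - m))⁻¹) := by
      rw [show n - m = n - (m + 1) + 1 by omega, f_succ]
    have h2 := ih (by omega)
    rw [indepCount_succ, Nat.cast_mul, Nat.cast_sub (Nat.pow_le_pow_right (by omega) (by omega)),
      mul_add, pow_add, mul_one]
    push_cast
    have h3 : (q : ℝ) ^ n = q ^ m * q ^ (n - m) := by
      rw [← pow_add]; congr 1; omega
    have h4 : (q : ℝ) ^ n - q ^ m = q ^ n * (1 - ((q : ℝ) ^ (n - m))⁻¹) := by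
      rw [h3]; field_simp
    rw [h1] at h2
    rw [h4]
    linear_combination (q : ℝ) ^ n * h2

theorem one_lt_card (K : Type*) [Field K] [Finite K] : 1 < Nat.card K := Finite.one_lt_card

variable (K) in
/-- The number of commuting pairs with `X` of corank `k`, divided by the order of the general
linear group. -/
def pairDensity (n k : ℕ) : ℝ :=
  corankCount K (Fin n → K) k / indepCount (Nat.card K) n n

/-- The normalization makes all powers of `q` in `corankCount_mul_indepCount` cancel, leaving a
convolution in the corank with kernel `1 / f`. -/
theorem pairDensity_add (n k : ℕ) : pairDensity K (n + k) k =
    ∑ j ∈ Finset.range (k + 1), pairDensity K n j / f (Nat.card K) (k - j) := by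
  have hq := one_lt_card K
  set q := Nat.card K with hqdef
  have hq' : (1 : ℝ) < q := by exact_mod_cast hq
  have hq0 : (0 : ℝ) < q := by positivity
  have e : ((Fin n → K) × (Fin k → K)) ≃ₗ[K] (Fin (n + k) → K) :=
    LinearEquiv.ofFinrankEq _ _ (by simp)
  have h1 := corankCount_mul_indepCount (K := K) (W := Fin n → K) (U := Fin k → K)
  rw [corankCount_congr e] at h1
  simp only [finrank_fin_fun, ← hqdef] at h1
  -- The two ranges differ only by zero terms: a corank cannot exceed `n`, and `indepCount q k j`
  -- vanishes for `j > k`.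
  have h2 : ∑ j ∈ Finset.range (n + 1), corankCount K (Fin n → K) j *
      (q ^ (k * (n - j)) * indepCount q k j * q ^ (k * k)) =
      ∑ j ∈ Finset.range (k + 1), corankCount K (Fin n → K) j *
      (q ^ (k * (n - j)) * indepCount q k j * q ^ (k * k)) := by
    rcases le_total n k with h | h
    · refine Finset.sum_subset (Finset.range_mono (by omega)) fun j _ hj => ?_
      rw [corankCount_eq_zero (by simp at hj ⊢; omega), zero_mul]
    · refine (Finset.sum_subset (Finset.range_mono (by omega)) fun j _ hj => ?_).symm
      rw [indepCount_eq_zero (by simp at hj; omega)]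
      simp
  rw [h2] at h1
  have hD (n : ℕ) : (indepCount q n n : ℝ) = q ^ (n * n) * f q n := by
    have := indepCount_mul_f hq (le_refl n)
    simpa [f] using this
  have hf (n : ℕ) : f (q : ℝ) n ≠ 0 := (f_pos hq' n).ne'
  have h3 : (indepCount q (n + k) n : ℝ) = q ^ ((n + k) * n) * f q (n + k) / f q k := by
    rw [eq_div_iff (hf k), ← indepCount_mul_f hq (Nat.le_add_right n k), Nat.add_sub_cancel_left]
  have h4 := congrArg (Nat.cast : ℕ → ℝ) h1
  push_cast at h4
  rw [hD, h3] at h4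
  unfold pairDensity
  rw [← hqdef, hD, div_eq_iff (mul_ne_zero (by positivity) (hf _)),
    ← mul_left_inj' (mul_ne_zero (pow_ne_zero (n * n) hq0.ne') (hf n)), h4, Finset.mul_sum,
    Finset.sum_mul, Finset.sum_mul]
  refine Finset.sum_congr rfl fun j hj => ?_
  have hj' : j ≤ k := by simp at hj; omega
  rcases lt_or_ge n j with h | h
  · rw [corankCount_eq_zero (by simpa using h)]
    simp
  have h5 : (indepCount q k j : ℝ) = q ^ (k * j) * f q k / f q (k - j) := by
    rw [eq_div_iff (hf _), ← indepCount_mul_f hq hj']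
  rw [h5, hD]
  have h6 : (q : ℝ) ^ ((n + k) * (n + k)) = q ^ ((n + k) * n) * q ^ (k * (n - j)) * q ^ (k * j) *
      q ^ (k * k) := by
    obtain ⟨d, rfl⟩ := Nat.exists_eq_add_of_le h
    rw [← pow_add, ← pow_add, ← pow_add, Nat.add_sub_cancel_left]
    congr 1
    ring
  rw [h6]
  have := hf n
  have := hf k
  have := hf (k - j)
  field_simp

end Density

/-! ### Corank zero and similarity classes -/

section Burnside

variable (K : Type*) [Field K] [Finite K]
variable (V : Type*) [AddCommGroup V] [Module K V] [Module.Finite K V]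

/-- The number of similarity classes of endomorphisms of `V`. -/
def classCount : ℕ :=
  Nat.card (Quotient (MulAction.orbitRel (ConjAct (End K V)ˣ) (End K V)))

theorem card_units_end :
    Nat.card (End K V)ˣ = indepCount (Nat.card K) (finrank K V) (finrank K V) := by
  rw [← card_linearEquiv]
  exact Nat.card_congr (LinearMap.GeneralLinearGroup.generalLinearEquiv K V).toEquiv

/-- Corank zero means that `X` is invertible, and commuting with `X` means being fixed by
conjugation with `X`. The pairs are thus those counted by Burnside's lemma. -/
theorem corankCount_zero : corankCount K V 0 =
    classCount K V * indepCount (Nat.card K) (finrank K V) (finrank K V) := by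
  classical
  rw [← card_units_end, classCount]
  have : Finite (End K V) := Module.finite_of_finite K
  have := Fintype.ofFinite (End K V)
  have := Fintype.ofFinite (ConjAct (End K V)ˣ)
  have := Fintype.ofFinite (Quotient (MulAction.orbitRel (ConjAct (End K V)ˣ) (End K V)))
  have h := MulAction.sum_card_fixedBy_eq_card_orbits_mul_card_group (ConjAct (End K V)ˣ) (End K V)
  rw [Nat.card_congr (ConjAct.toConjAct (G := (End K V)ˣ)).toEquiv,
    Nat.card_eq_fintype_card, Nat.card_eq_fintype_card, ← h]
  simp_rw [← Nat.card_eq_fintype_card]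
  rw [← Nat.card_sigma]
  refine Nat.card_congr ⟨fun p => ⟨ConjAct.toConjAct (LinearMap.isUnit_iff_range_eq_top p.1.1 |>.2
      (Submodule.eq_top_of_finrank_eq p.2.2)).unit, p.1.2, ?_⟩,
    fun x => ⟨((ConjAct.ofConjAct x.1 : (End K V)ˣ), x.2.1), ?_, ?_⟩, fun p => ?_, fun x => ?_⟩
  · rw [MulAction.mem_fixedBy, ConjAct.units_smul_def, Units.mul_inv_eq_iff_eq_mul]
    exact p.2.1
  · have := x.2.2
    rwa [MulAction.mem_fixedBy, ConjAct.units_smul_def, Units.mul_inv_eq_iff_eq_mul] at this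
  · rw [(LinearMap.isUnit_iff_range_eq_top _).1 (ConjAct.ofConjAct x.1).isUnit]
    simp
  · rfl
  · refine Sigma.subtype_ext ?_ rfl
    refine ConjAct.ofConjAct.injective (Units.ext ?_)
    rfl

theorem pairDensity_zero (n : ℕ) : pairDensity K n 0 = classCount K (Fin n → K) := by
  have h := f_pos (q := Nat.card K) (by exact_mod_cast one_lt_card K) n
  have := indepCount_mul_f (one_lt_card K) (le_refl n)
  have h0 : (indepCount (Nat.card K) n n : ℝ) ≠ 0 := by
    have hq0 : (0 : ℝ) < Nat.card K := by have := one_lt_card K; positivity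
    intro h1
    rw [h1, zero_mul] at this
    exact (mul_pos (pow_pos hq0 _) h).ne this
  rw [pairDensity, corankCount_zero, div_eq_iff (by simpa using h0)]
  simp

end Burnside

/-! ### Similarity classes as multisets of elementary divisors -/

section Classification

open Polynomial

universe u v w

variable {K : Type u} [Field K]

variable (K) in
/-- The monic irreducible polynomials over `K`. -/
abbrev Irr : Type u := {P : K[X] // P.Monic ∧ Irreducible P}

variable (K) in
/-- An elementary divisor `P ^ (e + 1)` is encoded as `(P, e)`. -/
abbrev ElemDiv : Type u := Irr K × ℕ

namespace ElemDiv

/-- The prime power encoded by an elementary divisor. -/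
def poly (a : ElemDiv K) : K[X] := a.1.1 ^ (a.2 + 1)

/-- The degree of an elementary divisor. -/
def deg (a : ElemDiv K) : ℕ := (a.2 + 1) * a.1.1.natDegree

theorem monic_poly (a : ElemDiv K) : a.poly.Monic := a.1.2.1.pow _

theorem natDegree_poly (a : ElemDiv K) : a.poly.natDegree = a.deg :=
  a.1.2.1.natDegree_pow _

instance (a : ElemDiv K) : Module.Finite K (K[X] ⧸ Ideal.span {a.poly}) :=
  a.monic_poly.finite_quotient

end ElemDiv

/-- The total degree of a multiset of elementary divisors. -/
def weight (τ : ElemDiv K →₀ ℕ) : ℕ := τ.sum fun a m => m * a.deg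

/-- The multiset of values of a finite family, as a finitely supported function. -/
def famType {ι : Type*} [Fintype ι] {α : Type*} (a : ι → α) : α →₀ ℕ := ∑ i, Finsupp.single (a i) 1

theorem famType_apply {ι : Type*} [Fintype ι] {α : Type*} [DecidableEq α] (a : ι → α) (c : α) :
    famType a c = ∑ i, if a i = c then 1 else 0 := by
  rw [famType, Finsupp.finsetSum_apply]
  simp [Finsupp.single_apply]

theorem weight_famType {ι : Type*} [Fintype ι] (a : ι → ElemDiv K) :
    weight (famType a) = ∑ i, (a i).deg := by
  rw [weight, famType, ← Finsupp.sum_finsetSum_index (by simp) (by intros; ring)]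
  simp

theorem exists_famType {α : Type u} (τ : α →₀ ℕ) :
    ∃ (ι : Type u) (_ : Fintype ι) (a : ι → α), famType a = τ := by
  classical
  refine ⟨Σ x : τ.support, Fin (τ x), inferInstance, fun i => i.1, ?_⟩
  ext c
  rw [famType_apply, Fintype.sum_sigma]
  have hsum (x : τ.support) : (∑ y : Fin (τ x), if x.1 = c then 1 else 0) =
      if x.1 = c then τ x else 0 := by
    split_ifs <;> simp
  refine (Finset.sum_congr rfl fun x _ => hsum x).trans ?_
  by_cases hc : c ∈ τ.support
  · rw [Finset.sum_eq_single ⟨c, hc⟩] <;> aesop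
  · rw [Finset.sum_eq_zero]
    · simpa using (by simpa using hc : τ c = 0).symm
    · rintro ⟨x, hx⟩ _
      rw [if_neg]
      rintro rfl
      exact hc hx

theorem exists_equiv_of_famType_eq {ι ι' α : Type*} [Fintype ι] [Fintype ι'] (a : ι → α)
    (a' : ι' → α) (h : famType a = famType a') : ∃ σ : ι ≃ ι', a = a' ∘ σ := by
  classical
  have key (c : α) : Nonempty ({i // a i = c} ≃ {i // a' i = c}) := by
    rw [← Fintype.card_eq, Fintype.card_subtype, Fintype.card_subtype, Finset.card_filter,
      Finset.card_filter, ← famType_apply, ← famType_apply, h]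
  let e := fun c => (key c).some
  refine ⟨(Equiv.sigmaFiberEquiv a).symm.trans ((Equiv.sigmaCongrRight fun c => (e c)).trans
    (Equiv.sigmaFiberEquiv a')), ?_⟩
  ext i
  exact (e (a i) ⟨i, rfl⟩).2.symm

/-- `M` is the direct sum of the cyclic modules with elementary divisors `τ`. -/
def HasType (M : Type v) [AddCommGroup M] [Module K[X] M] (τ : ElemDiv K →₀ ℕ) : Prop :=
  ∃ (ι : Type u) (_ : Fintype ι) (a : ι → ElemDiv K),
    Nonempty (M ≃ₗ[K[X]] ∀ i, K[X] ⧸ Ideal.span {(a i).poly}) ∧ famType a = τ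

section

variable {M : Type v} [AddCommGroup M] [Module K[X] M] {M' : Type w} [AddCommGroup M']
  [Module K[X] M']

theorem HasType.congr {τ : ElemDiv K →₀ ℕ} (h : HasType M τ) (e : M' ≃ₗ[K[X]] M) :
    HasType M' τ := by
  obtain ⟨ι, _, a, ⟨e'⟩, h⟩ := h
  exact ⟨ι, _, a, ⟨e.trans e'⟩, h⟩

theorem HasType.nonempty_equiv {τ : ElemDiv K →₀ ℕ} (h : HasType M τ) (h' : HasType M' τ) :
    Nonempty (M ≃ₗ[K[X]] M') := by
  obtain ⟨ι, _, a, ⟨e⟩, h⟩ := h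
  obtain ⟨ι', _, a', ⟨e'⟩, h'⟩ := h'
  obtain ⟨σ, rfl⟩ := exists_equiv_of_famType_eq a a' (h.trans h'.symm)
  exact ⟨(e.trans (LinearEquiv.piCongrLeft K[X]
    (fun i => K[X] ⧸ Ideal.span {(a' i).poly}) σ)).trans e'.symm⟩

theorem exists_hasType [Module.Finite K[X] M] (hM : IsTorsion K[X] M) :
    ∃ τ : ElemDiv K →₀ ℕ, HasType M τ := by
  classical
  obtain ⟨ι, _, p, hp, e, ⟨E⟩⟩ := equiv_directSum_of_isTorsion hM
  -- The structure theorem allows trivial factors with `e i = 0` and irreducibles that are not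
  -- monic. The former are dropped, the latter normalized; `e i - 1` appears because `(P, e)`
  -- encodes `P ^ (e + 1)`.
  let a : {i // e i ≠ 0} → ElemDiv K := fun i =>
    (⟨normalize (p i), monic_normalize (hp i).ne_zero,
      (associated_normalize (p i)).irreducible (hp i)⟩, e i - 1)
  have ha (i : {i // e i ≠ 0}) : Submodule.span K[X] {p i ^ e i} = Ideal.span {(a i).poly} := by
    refine Ideal.span_singleton_eq_span_singleton.2 ?_
    have : e i - 1 + 1 = e i := Nat.sub_add_cancel (Nat.one_le_iff_ne_zero.2 i.2)
    simp only [ElemDiv.poly, a, this]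
    exact (associated_normalize (p i)).pow_pow
  let L : (∀ i, K[X] ⧸ Submodule.span K[X] {p i ^ e i}) →ₗ[K[X]]
      ∀ i : {i // e i ≠ 0}, K[X] ⧸ Submodule.span K[X] {p i ^ e i} :=
    LinearMap.pi fun i => LinearMap.proj i.1
  have hsub (i : ι) (hi : e i = 0) : Subsingleton (K[X] ⧸ Submodule.span K[X] {p i ^ e i}) := by
    rw [hi, pow_zero]
    exact Submodule.Quotient.subsingleton_iff.2 Ideal.span_singleton_one
  have hL : Function.Bijective L := by
    constructor
    · intro x y hxy
      funext i
      by_cases hi : e i = 0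
      · exact (hsub i hi).elim _ _
      · exact congrFun hxy ⟨i, hi⟩
    · intro y
      refine ⟨fun i => if hi : e i ≠ 0 then y ⟨i, hi⟩ else 0, ?_⟩
      funext i
      exact dif_pos i.2
  exact ⟨_, {i // e i ≠ 0}, inferInstance, a,
    ⟨(E.trans (DirectSum.linearEquivFunOnFintype _ _ _)).trans ((LinearEquiv.ofBijective L hL).trans
      (LinearEquiv.piCongrRight fun i => Submodule.quotEquivOfEq _ _ (ha i)))⟩, rfl⟩

theorem HasType.finrank_eq [Module K M] [IsScalarTower K K[X] M] {τ : ElemDiv K →₀ ℕ}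
    (h : HasType M τ) : finrank K M = weight τ := by
  obtain ⟨ι, _, a, ⟨E⟩, rfl⟩ := h
  rw [(E.restrictScalars K).finrank_eq, weight_famType, finrank_pi_fintype]
  refine Finset.sum_congr rfl fun i _ => ?_
  rw [finrank_quotient_span_eq_natDegree, ElemDiv.natDegree_poly]

end

variable [Finite K]

/-- The number of elements of a cyclic module annihilated by the power of an irreducible. -/
theorem card_torsion_cyclic (P : Irr K) (k : ℕ) (a : ElemDiv K) [Decidable (a.1 = P)] :
    Nat.card {x : K[X] ⧸ Ideal.span {a.poly} // P.1 ^ k • x = 0} =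
      Nat.card K ^ (P.1.natDegree * if a.1 = P then min (a.2 + 1) k else 0) := by
  have hmk (r : K[X]) (g s : K[X]) : s • (Submodule.Quotient.mk r : K[X] ⧸ Ideal.span {g}) = 0 ↔
      g ∣ s * r := by
    rw [← Submodule.Quotient.mk_smul, Submodule.Quotient.mk_eq_zero, Ideal.mem_span_singleton,
      smul_eq_mul]
  have hfin (n : ℕ) : Module.Finite K (K[X] ⧸ Ideal.span {P.1 ^ n}) :=
    (P.2.1.pow n).finite_quotient
  have hcard (n : ℕ) : Nat.card (K[X] ⧸ Ideal.span {P.1 ^ n}) =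
      Nat.card K ^ (P.1.natDegree * n) := by
    rw [natCard_eq_pow_finrank (K := K), finrank_quotient_span_eq_natDegree,
      P.2.1.natDegree_pow, mul_comm]
  split_ifs with h
  · obtain ⟨Q, m⟩ := a
    obtain rfl : Q = P := h
    change Nat.card {x : K[X] ⧸ Ideal.span {Q.1 ^ (m + 1)} // Q.1 ^ k • x = 0} =
      Nat.card K ^ (Q.1.natDegree * min (m + 1) k)
    -- The `Q ^ k`-torsion is the kernel of reduction modulo `Q ^ (m + 1 - k)`. The truncated
    -- subtraction is right: for `k ≥ m + 1` the target is zero and everything is torsion.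
    have hle : Ideal.span {Q.1 ^ (m + 1)} ≤ Ideal.span {Q.1 ^ (m + 1 - k)} :=
      Ideal.span_singleton_le_span_singleton.2 (pow_dvd_pow _ (Nat.sub_le _ _))
    let φ := Submodule.factor hle
    have hφ : Function.Surjective φ := Submodule.factor_surjective hle
    have hker (x : K[X] ⧸ Ideal.span {Q.1 ^ (m + 1)}) : Q.1 ^ k • x = 0 ↔ x ∈ φ.ker := by
      obtain ⟨r, rfl⟩ := Submodule.Quotient.mk_surjective _ x
      rw [hmk, LinearMap.mem_ker]
      change _ ↔ (Submodule.Quotient.mk r : K[X] ⧸ Ideal.span {Q.1 ^ (m + 1 - k)}) = 0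
      rw [Submodule.Quotient.mk_eq_zero, Ideal.mem_span_singleton]
      rcases le_total k (m + 1) with hk | hk
      · have h1 : Q.1 ^ (m + 1) = Q.1 ^ k * Q.1 ^ (m + 1 - k) := by
          rw [← pow_add]; congr 1; omega
        rw [h1, mul_dvd_mul_iff_left (pow_ne_zero _ Q.2.1.ne_zero)]
      · rw [Nat.sub_eq_zero_of_le hk, pow_zero]
        exact iff_of_true (dvd_mul_of_dvd_left (pow_dvd_pow _ hk) _) (one_dvd _)
    have h1 := φ.ker.card_eq_card_quotient_mul_card
    rw [Nat.card_congr (φ.quotKerEquivOfSurjective hφ).toEquiv, hcard, hcard] at h1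
    have h2 : m + 1 = min (m + 1) k + (m + 1 - k) := by omega
    rw [Nat.card_congr (Equiv.subtypeEquivRight hker)]
    have h3 : 0 < Nat.card K ^ (Q.1.natDegree * (m + 1 - k)) :=
      pow_pos (by have := one_lt_card K; omega) _
    refine Nat.eq_of_mul_eq_mul_right h3 (h1.symm.trans ?_)
    rw [← pow_add, ← mul_add, ← h2]
  · rw [mul_zero, pow_zero, Nat.card_eq_one_iff_unique]
    refine ⟨⟨fun x y => Subtype.ext ?_⟩, ⟨⟨0, smul_zero _⟩⟩⟩
    have hz (x : {x : K[X] ⧸ Ideal.span {a.poly} // P.1 ^ k • x = 0}) : x.1 = 0 := by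
      obtain ⟨x, hx⟩ := x
      -- For distinct monic irreducibles `P ^ k` acts invertibly, so zero is the only torsion
      -- element.
      have hcop : IsCoprime (P.1 ^ k) a.poly := by
        refine IsCoprime.pow ((P.2.2.coprime_iff_not_dvd).2 fun hd => h ?_)
        exact Subtype.ext (eq_of_monic_of_associated a.1.2.1 P.2.1
          (P.2.2.associated_of_dvd a.1.2.2 hd).symm)
      obtain ⟨u, v, huv⟩ := hcop
      obtain ⟨r, rfl⟩ := Submodule.Quotient.mk_surjective _ x
      change (Submodule.Quotient.mk r : K[X] ⧸ Ideal.span {a.poly}) = 0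
      rw [← one_smul K[X] (Submodule.Quotient.mk r : K[X] ⧸ Ideal.span {a.poly}), ← huv, add_smul,
        mul_smul, hx, smul_zero, zero_add, hmk]
      exact dvd_mul_of_dvd_left (dvd_mul_left _ _) _
    rw [hz, hz]

/-- The number of elements killed by `P ^ k` determines the sum of `min (e + 1) k` over the
elementary divisors `P ^ (e + 1)`. The multiplicity of `P ^ (k + 1)` is minus a second difference in
`k` of these sums. -/
theorem HasType.unique {M : Type v} [AddCommGroup M] [Module K[X] M] {τ τ' : ElemDiv K →₀ ℕ}
    (h : HasType M τ) (h' : HasType M τ') : τ = τ' := by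
  classical
  obtain ⟨ι, _, a, ⟨e⟩, rfl⟩ := h
  obtain ⟨ι', _, a', ⟨e'⟩, rfl⟩ := h'
  have key {ι : Type u} [Fintype ι] (a : ι → ElemDiv K)
      (e : M ≃ₗ[K[X]] ∀ i, K[X] ⧸ Ideal.span {(a i).poly}) (P : Irr K) (k : ℕ) :
      Nat.card {x : M // P.1 ^ k • x = 0} = Nat.card K ^ (P.1.natDegree *
        ∑ i, if (a i).1 = P then min ((a i).2 + 1) k else 0) := by
    rw [Finset.mul_sum, ← Finset.prod_pow_eq_pow_sum]
    simp_rw [← card_torsion_cyclic]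
    rw [← Nat.card_pi]
    refine Nat.card_congr ((e.toEquiv.subtypeEquiv fun x => ?_).trans
      (Equiv.subtypePiEquivPi (p := fun i (x : K[X] ⧸ Ideal.span {(a i).poly}) =>
        P.1 ^ k • x = 0)))
    rw [← e.map_eq_zero_iff, map_smul, funext_iff]
    rfl
  have key2 (P : Irr K) (k : ℕ) :
      (∑ i, if (a i).1 = P then min ((a i).2 + 1) k else 0) =
      ∑ i, if (a' i).1 = P then min ((a' i).2 + 1) k else 0 := by
    have h1 := (key a e P k).symm.trans (key a' e' P k)
    exact Nat.eq_of_mul_eq_mul_left P.2.2.natDegree_pos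
      (Nat.pow_right_injective (one_lt_card K) h1)
  -- As a function of `k`, `min (e + 1) k` has a single kink, at `k = e + 1`.
  have key3 {ι : Type u} [Fintype ι] (a : ι → ElemDiv K) (P : Irr K) (k : ℕ) :
      famType a (P, k) + (∑ i, if (a i).1 = P then min ((a i).2 + 1) k else 0) +
        (∑ i, if (a i).1 = P then min ((a i).2 + 1) (k + 2) else 0) =
      2 * ∑ i, if (a i).1 = P then min ((a i).2 + 1) (k + 1) else 0 := by
    rw [famType_apply, ← Finset.sum_add_distrib, ← Finset.sum_add_distrib, Finset.mul_sum]
    refine Finset.sum_congr rfl fun i _ => ?_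
    by_cases h1 : (a i).1 = P
    · by_cases h2 : (a i).2 = k
      · rw [if_pos (Prod.ext h1 h2), if_pos h1, if_pos h1, if_pos h1]
        omega
      · rw [if_neg (fun h => h2 (congrArg Prod.snd h)), if_pos h1, if_pos h1, if_pos h1]
        omega
    · simp [h1, show a i ≠ (P, k) from fun h => h1 (congrArg Prod.fst h)]
  ext ⟨P, k⟩
  have h1 := key3 a P k
  have h2 := key3 a' P k
  rw [key2, key2, key2 P (k + 1)] at h1
  omega

section Similarity

variable {V : Type v} [AddCommGroup V] [Module K V] [Module.Finite K V]

theorem orbitRel_iff_nonempty_equiv (A B : End K V) :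
    (MulAction.orbitRel (ConjAct (End K V)ˣ) (End K V)) A B ↔
      Nonempty (AEval' A ≃ₗ[K[X]] AEval' B) := by
  rw [MulAction.orbitRel_apply]
  constructor
  · rintro ⟨g, hg⟩
    let g' : (End K V)ˣ := ConjAct.ofConjAct g
    have hg' : (g' : End K V) * B * (g'⁻¹ : (End K V)ˣ) = A := hg
    rw [Units.mul_inv_eq_iff_eq_mul] at hg'
    refine ⟨(LinearEquiv.ofAEval B ((LinearMap.GeneralLinearGroup.generalLinearEquiv K V
      g').trans (AEval'.of A)) fun m => ?_).symm⟩
    change AEval'.of A ((g' : End K V) (B m)) =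
      (X : K[X]) • AEval'.of A ((g' : End K V) m)
    rw [AEval'.X_smul_of]
    exact congrArg _ (LinearMap.congr_fun hg' m)
  · rintro ⟨e⟩
    let e' : V ≃ₗ[K] V := (AEval'.of B).trans ((e.symm.restrictScalars K).trans (AEval'.of A).symm)
    refine ⟨ConjAct.toConjAct ((LinearMap.GeneralLinearGroup.generalLinearEquiv K V).symm e'), ?_⟩
    change _ * _ * _ = _
    rw [Units.mul_inv_eq_iff_eq_mul]
    ext m
    change (AEval'.of A).symm (e.symm (AEval'.of B (B m))) =
      A ((AEval'.of A).symm (e.symm (AEval'.of B m)))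
    rw [← AEval'.X_smul_of, map_smul, AEval'.of_symm_X_smul]

theorem exists_hasType_aeval (A : End K V) : ∃ τ : ElemDiv K →₀ ℕ, HasType (AEval' A) τ :=
  exists_hasType (K := K) (AEval.isTorsion_of_finiteDimensional K V A)

theorem exists_aeval_hasType (τ : ElemDiv K →₀ ℕ) (h : weight τ = finrank K V) :
    ∃ A : End K V, HasType (AEval' A) τ := by
  obtain ⟨ι, _, a, rfl⟩ := exists_famType τ
  let M := ∀ i, K[X] ⧸ Ideal.span {(a i).poly}
  have hM : HasType M (famType a) := ⟨ι, _, a, ⟨LinearEquiv.refl _ _⟩, rfl⟩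
  have e : V ≃ₗ[K] M := LinearEquiv.ofFinrankEq _ _ (by rw [hM.finrank_eq, h])
  let L : M →ₗ[K] M := Algebra.lsmul K K M (X : K[X])
  let A : End K V := e.symm.toLinearMap ∘ₗ L ∘ₗ e.toLinearMap
  refine ⟨A, hM.congr (LinearEquiv.ofAEval A e fun m => ?_)⟩
  change e (e.symm (L (e m))) = _
  rw [e.apply_symm_apply]
  rfl

/-- An endomorphism makes the space a torsion `K[X]`-module; similarity is isomorphism of these
modules, and the type is a complete invariant which takes every value of weight `n`. -/
theorem classCount_eq (n : ℕ) :
    classCount K (Fin n → K) = Nat.card {τ : ElemDiv K →₀ ℕ // weight τ = n} := by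
  choose T hT using fun A : End K (Fin n → K) => exists_hasType_aeval A
  have hw (A : End K (Fin n → K)) : weight (T A) = n := by
    rw [← (hT A).finrank_eq, (AEval'.of A).symm.finrank_eq, finrank_fin_fun]
  have hrel (A B) : (MulAction.orbitRel (ConjAct (End K (Fin n → K))ˣ) (End K (Fin n → K))) A B ↔
      T A = T B := by
    rw [orbitRel_iff_nonempty_equiv]
    constructor
    · rintro ⟨e⟩
      exact (hT A).unique ((hT B).congr e)
    · intro h
      exact (hT A).nonempty_equiv (h ▸ hT B)
  refine Nat.card_eq_of_bijective (Quotient.lift (fun A => (⟨T A, hw A⟩ :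
    {τ : ElemDiv K →₀ ℕ // weight τ = n})) fun A B h => Subtype.ext ((hrel A B).1 h)) ⟨?_, ?_⟩
  · rintro ⟨A⟩ ⟨B⟩ h
    exact Quotient.sound ((hrel A B).2 (congrArg Subtype.val h))
  · rintro ⟨τ, hτ⟩
    obtain ⟨A, hA⟩ := exists_aeval_hasType (V := Fin n → K) τ (by rw [hτ, finrank_fin_fun])
    exact ⟨Quotient.mk _ A, Subtype.ext ((hT A).unique hA)⟩

end Similarity

end Classification

/-! ### The generating function of similarity classes -/

section TypeSeries

open Polynomial
open scoped ENNReal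

universe u

theorem tsum_pow_eq_tsum_card {α : Type*} (w : α → ℕ) (hw : ∀ n, Finite {a // w a = n})
    (x : ℝ≥0∞) : ∑' a, x ^ w a = ∑' n, (Nat.card {a // w a = n} : ℝ≥0∞) * x ^ n := by
  rw [← (Equiv.sigmaFiberEquiv w).tsum_eq, ENNReal.tsum_sigma' ]
  refine tsum_congr fun n => ?_
  have := Fintype.ofFinite {a // w a = n}
  rw [Nat.card_eq_fintype_card, tsum_fintype, Finset.sum_congr rfl (g := fun _ => x ^ n)
    (fun a _ => by simp [Equiv.sigmaFiberEquiv, a.2])]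
  simp

/-- The sum over finitely supported families of a product is an increasing union of finite
products of sums. -/
theorem tsum_finsupp_prod {M : Type*} [AddCommMonoid M] (φ : ℕ → M → ℝ≥0∞)
    (hφ : ∀ e, φ e 0 = 1) :
    ∑' σ : ℕ →₀ M, σ.prod φ = ⨆ L, ∏ e ∈ Finset.range L, ∑' m, φ e m := by
  classical
  have key (L : ℕ) : ∑' σ : {σ : ℕ →₀ M // σ.support ⊆ Finset.range L}, σ.1.prod φ =
      ∏ e ∈ Finset.range L, ∑' m, φ e m := by
    induction L with
    | zero =>
      rw [tsum_eq_single ⟨0, by simp⟩]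
      · simp
      · rintro ⟨σ, hσ⟩ h
        refine absurd (Subtype.ext ?_) h
        simpa using hσ
    | succ L ih =>
      -- A family supported below `L + 1` is one supported below `L` together with a free value at
      -- `L`.
      let E : ({σ : ℕ →₀ M // σ.support ⊆ Finset.range L} × M) ≃
          {σ : ℕ →₀ M // σ.support ⊆ Finset.range (L + 1)} :=
        { toFun := fun p => ⟨p.1.1.update L p.2, fun e he => by
            rw [Finsupp.mem_support_iff, Finsupp.coe_update] at he
            by_cases h : e = L
            · simp [h]
            · rw [Function.update_of_ne h, ← Finsupp.mem_support_iff] at he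
              have := p.1.2 he
              simp only [Finset.mem_range] at this ⊢
              omega⟩
          invFun := fun σ => (⟨σ.1.erase L, fun e he => by
            rw [Finsupp.support_erase, Finset.mem_erase] at he
            have := σ.2 he.2
            simp only [Finset.mem_range] at this ⊢
            omega⟩, σ.1 L)
          left_inv := fun p => by
            have hL : p.1.1 L = 0 := by
              by_contra h
              have := p.1.2 (Finsupp.mem_support_iff.2 h)
              simp at this
            refine Prod.ext (Subtype.ext ?_) (by simp)
            ext e
            by_cases h : e = L
            · simp [h, hL]
            · simp [Finsupp.erase_ne h]
          right_inv := fun σ => by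
            refine Subtype.ext ?_
            ext e
            rcases eq_or_ne e L with rfl | h
            · simp
            · simp }
      rw [← E.tsum_eq, Finset.prod_range_succ, ← ih, ← ENNReal.tsum_mul_right, ENNReal.tsum_prod']
      refine tsum_congr fun σ => ?_
      rw [← ENNReal.tsum_mul_left]
      refine tsum_congr fun m => ?_
      rw [Finsupp.prod_of_support_subset _ (E (σ, m)).2 _ (fun e _ => hφ e),
        Finsupp.prod_of_support_subset _ σ.2 _ (fun e _ => hφ e), Finset.prod_range_succ]
      congr 1
      · refine Finset.prod_congr rfl fun e he => ?_
        rw [Finset.mem_range] at he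
        simp [E, Function.update_of_ne he.ne]
      · simp [E]
  apply le_antisymm
  · rw [ENNReal.tsum_eq_iSup_sum]
    refine iSup_le fun s => ?_
    obtain ⟨L, hL⟩ : ∃ L, ∀ σ ∈ s, σ.support ⊆ Finset.range L := by
      refine ⟨(s.sup fun σ => σ.support.sup id) + 1, fun σ hσ e he => ?_⟩
      rw [Finset.mem_range, Nat.lt_succ_iff]
      exact (Finset.le_sup (f := id) he).trans
        (Finset.le_sup (f := fun σ : ℕ →₀ M => σ.support.sup id) hσ)
    refine le_trans ?_ (le_iSup _ L)
    rw [← key, ← Finset.sum_subtype_of_mem (p := fun σ => σ.support ⊆ Finset.range L) _ hL]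
    exact ENNReal.sum_le_tsum _
  · refine iSup_le fun L => ?_
    rw [← key]
    exact ENNReal.tsum_comp_le_tsum_of_injective Subtype.val_injective
      (fun σ : ℕ →₀ M => σ.prod φ)

variable (K : Type u) [Field K] [Finite K]

theorem card_monic (d : ℕ) : Nat.card {g : {g : K[X] // g.Monic} // g.1.natDegree = d} =
    Nat.card K ^ d := by
  have := Fintype.ofFinite K
  rw [Nat.card_congr ((Equiv.subtypeSubtypeEquivSubtypeInter _ _).trans
    ((monicEquivDegreeLT d).trans (degreeLTEquiv K d).toEquiv))]
  rw [Nat.card_fun, Nat.card_fin]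

/-- The degree of a multiset of monic irreducible polynomials. -/
def irrDeg (m : Irr K →₀ ℕ) : ℕ := m.sum fun P c => c * P.1.natDegree

/-- Unique factorization of monic polynomials. -/
theorem exists_equiv_monic : ∃ e : (Irr K →₀ ℕ) ≃ {g : K[X] // g.Monic},
    ∀ m, (e m).1.natDegree = irrDeg K m := by
  classical
  have hmon (s : Multiset (Irr K)) : (s.map fun P : Irr K => P.1).prod.Monic :=
    monic_multiset_prod_of_monic _ _ fun P _ => P.2.1
  let F : Multiset (Irr K) → {g : K[X] // g.Monic} := fun s => ⟨(s.map fun P : Irr K => P.1).prod, hmon s⟩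
  have hF : Function.Bijective F := by
    constructor
    · intro s t h
      have h1 := UniqueFactorizationMonoid.factors_unique (f := s.map fun P : Irr K => P.1)
        (g := t.map fun P : Irr K => P.1)
        (by simp only [Multiset.mem_map]; rintro x ⟨P, -, rfl⟩; exact P.2.2)
        (by simp only [Multiset.mem_map]; rintro x ⟨P, -, rfl⟩; exact P.2.2)
        (by
          have h2 : (s.map fun P : Irr K => P.1).prod = (t.map fun P : Irr K => P.1).prod :=
            congrArg Subtype.val h
          rw [h2]; exact Associated.refl _)
      refine Multiset.map_injective Subtype.val_injective (Multiset.rel_eq.1 (h1.mono ?_))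
      simp only [Multiset.mem_map]
      rintro a ⟨P, -, rfl⟩ b ⟨P', -, rfl⟩ hab
      exact eq_of_monic_of_associated P.2.1 P'.2.1 hab
    · rintro ⟨g, hg⟩
      obtain ⟨s, hs, hsg⟩ := WfDvdMonoid.exists_factors g hg.ne_zero
      have hs' : ∀ P ∈ s.map normalize, P.Monic ∧ Irreducible P := by
        simp only [Multiset.mem_map]
        rintro _ ⟨P, hP, rfl⟩
        exact ⟨monic_normalize (hs P hP).ne_zero,
          (associated_normalize P).irreducible (hs P hP)⟩
      obtain ⟨t, ht⟩ : ∃ t : Multiset (Irr K), t.map (fun P => P.1) = s.map normalize :=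
        ⟨(s.map normalize).pmap Subtype.mk hs', by
          rw [Multiset.map_pmap]
          simp [Multiset.pmap_eq_map]⟩
      refine ⟨t, Subtype.ext (eq_of_monic_of_associated (hmon t) hg ?_)⟩
      change Associated (t.map fun P : Irr K => P.1).prod g
      rw [ht]
      refine Associated.trans ?_ hsg
      clear ht hs' hsg hs
      induction s using Multiset.induction with
      | empty => simp
      | cons P s ih =>
        rw [Multiset.map_cons, Multiset.prod_cons, Multiset.prod_cons]
        exact (associated_normalize P).symm.mul_mul ih
  refine ⟨(Multiset.toFinsupp.symm.toEquiv).trans (Equiv.ofBijective F hF), fun m => ?_⟩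
  change ((Finsupp.toMultiset m).map fun P : Irr K => P.1).prod.natDegree = _
  rw [natDegree_multiset_prod_of_monic _ (by
    simp only [Multiset.mem_map]; rintro x ⟨P, -, rfl⟩; exact P.2.1), Multiset.map_map,
    Finsupp.toMultiset_map, Finsupp.sum_toMultiset, Finsupp.sum_mapDomain_index (by simp)
    (by intros; rw [add_smul])]
  rfl

/-- By unique factorization this is the sum over monic polynomials, `q ^ d` of them in degree `d`.
In `ℝ≥0∞` no bound on `z` is needed: once `q z ≥ 1` both sides are `⊤`. -/
theorem tsum_pow_irrDeg (z : ℝ≥0∞) :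
    ∑' m : Irr K →₀ ℕ, z ^ irrDeg K m = (1 - Nat.card K * z)⁻¹ := by
  obtain ⟨e, he⟩ := exists_equiv_monic K
  have h1 : ∑' m : Irr K →₀ ℕ, z ^ irrDeg K m = ∑' g : {g : K[X] // g.Monic}, z ^ g.1.natDegree := by
    rw [← e.tsum_eq]
    simp_rw [he]
  rw [h1, tsum_pow_eq_tsum_card, ← ENNReal.tsum_geometric]
  · simp_rw [card_monic, mul_pow]
    simp
  · intro n
    refine Nat.finite_of_card_ne_zero ?_
    rw [card_monic]
    exact pow_ne_zero _ (by have := one_lt_card K; omega)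

/-- Grouping elementary divisors by exponent leaves, for each `e`, an independent multiset of
irreducibles. It contributes the series `tsum_pow_irrDeg` at `x ^ (e + 1)`. -/
theorem tsum_classCount (x : ℝ≥0∞) :
    ∑' n, (classCount K (Fin n → K) : ℝ≥0∞) * x ^ n =
      ⨆ L, ∏ e ∈ Finset.range L, (1 - Nat.card K * x ^ (e + 1))⁻¹ := by
  classical
  -- `Nat.card` is `0` on infinite types, so nonvanishing supplies finiteness of the sets of types
  -- of given weight.
  have hpos (n : ℕ) : classCount K (Fin n → K) ≠ 0 := by
    have : Finite (End K (Fin n → K)) := Module.finite_of_finite K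
    rw [classCount]
    exact Nat.card_ne_zero.2 ⟨⟨Quotient.mk _ 0⟩, inferInstance⟩
  simp_rw [classCount_eq] at hpos ⊢
  rw [← tsum_pow_eq_tsum_card _ (fun n => Nat.finite_of_card_ne_zero (hpos n))]
  let E : (ElemDiv K →₀ ℕ) ≃ (ℕ →₀ (Irr K →₀ ℕ)) :=
    (Finsupp.domCongr (Equiv.prodComm _ _)).toEquiv.trans Finsupp.curryEquiv
  have hE (τ : ElemDiv K →₀ ℕ) : x ^ weight τ = (E τ).prod fun e m => x ^ ((e + 1) * irrDeg K m) := by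
    rw [Finsupp.prod, Finset.prod_pow_eq_pow_sum]
    congr 1
    have h1 := Finsupp.sum_curry_index (Finsupp.equivMapDomain (Equiv.prodComm _ _) τ)
      (fun e (P : Irr K) c => c * ((e + 1) * P.1.natDegree))
    rw [Finsupp.sum_equivMapDomain] at h1
    refine h1.symm.trans ?_
    refine Finset.sum_congr rfl fun e _ => ?_
    unfold irrDeg Finsupp.sum
    rw [Finset.mul_sum]
    refine Finset.sum_congr rfl fun P _ => ?_
    exact mul_left_comm _ _ _
  simp_rw [hE]
  rw [E.tsum_eq (fun σ => σ.prod fun e m => x ^ ((e + 1) * irrDeg K m)),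
    tsum_finsupp_prod _ (by simp [irrDeg])]
  simp_rw [pow_mul, tsum_pow_irrDeg]

end TypeSeries

/-! ### Solving the recursion in extended nonnegative reals -/

section CorankSeries

open scoped ENNReal Topology

/-- The two-variable series of an array, evaluated at `(x, x ^ j)`. -/
def arraySeries (β : ℕ → ℕ → ℝ≥0∞) (x : ℝ≥0∞) (j : ℕ) : ℝ≥0∞ :=
  ∑' k, ∑' n, β n k * x ^ (n + j * k)

theorem tsum_antidiagonal (g : ℕ × ℕ → ℝ≥0∞) :
    ∑' k, ∑ p ∈ Finset.HasAntidiagonal.antidiagonal k, g p = ∑' p, g p := by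
  rw [← (Finset.HasAntidiagonal.sigmaAntidiagonalEquivProd (A := ℕ)).tsum_eq g, ENNReal.tsum_sigma']
  refine tsum_congr fun k => ?_
  rw [tsum_fintype, ← Finset.sum_coe_sort]
  rfl

/-- Terms with `n < k` vanish, so `n` may be replaced by `n + k`. This puts `β (n + k) k` in view,
and the recursion then relates level `j` to level `j + 1`. -/
theorem arraySeries_shift (β : ℕ → ℕ → ℝ≥0∞) (hβ : ∀ n k, n < k → β n k = 0) (x : ℝ≥0∞) (j : ℕ) :
    arraySeries β x j = ∑' k, ∑' n, β (n + k) k * x ^ (n + (j + 1) * k) := by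
  refine tsum_congr fun k => ?_
  have h := Summable.sum_add_tsum_nat_add' (f := fun n => β n k * x ^ (n + j * k)) (k := k)
    ENNReal.summable
  rw [← h, Finset.sum_eq_zero (fun n hn => by rw [hβ n k (Finset.mem_range.1 hn), zero_mul]),
    zero_add]
  refine tsum_congr fun n => ?_
  rw [show n + k + j * k = n + (j + 1) * k by ring]

theorem arraySeries_mul (β : ℕ → ℕ → ℝ≥0∞) (ε : ℕ → ℝ≥0∞) (x : ℝ≥0∞) (j : ℕ) :
    arraySeries β x j * ∑' m, ε m * (x ^ j) ^ m =
      ∑' k, ∑' n, (∑ i ∈ Finset.range (k + 1), β n i * ε (k - i)) * x ^ (n + j * k) := by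
  have h1 (k : ℕ) : ∑' n, (∑ i ∈ Finset.range (k + 1), β n i * ε (k - i)) * x ^ (n + j * k) =
      ∑ p ∈ Finset.HasAntidiagonal.antidiagonal k,
        (∑' n, β n p.1 * x ^ (n + j * p.1)) * (ε p.2 * (x ^ j) ^ p.2) := by
    rw [Finset.Nat.sum_antidiagonal_eq_sum_range_succ
      (fun a b => (∑' n, β n a * x ^ (n + j * a)) * (ε b * (x ^ j) ^ b))]
    simp_rw [Finset.sum_mul]
    rw [Summable.tsum_finsetSum (fun _ _ => ENNReal.summable)]
    refine Finset.sum_congr rfl fun i hi => ?_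
    rw [← ENNReal.tsum_mul_right]
    refine tsum_congr fun n => ?_
    obtain ⟨d, rfl⟩ := Nat.exists_eq_add_of_le (Nat.lt_succ_iff.1 (Finset.mem_range.1 hi))
    rw [Nat.add_sub_cancel_left, mul_add, pow_add, pow_add, pow_add, pow_mul x j d]
    ring
  simp_rw [h1]
  rw [tsum_antidiagonal (fun p => (∑' n, β n p.1 * x ^ (n + j * p.1)) * (ε p.2 * (x ^ j) ^ p.2)),
    ENNReal.tsum_prod', arraySeries, ← ENNReal.tsum_mul_right]
  refine tsum_congr fun i => ?_
  rw [← ENNReal.tsum_mul_left]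

variable (β : ℕ → ℕ → ℝ≥0∞) (ε : ℕ → ℝ≥0∞) (x : ℝ≥0∞)

/-- Only an inequality is assumed, because the truncations in `arraySeries_zero_eq` satisfy the
recursion only as an inequality. -/
theorem arraySeries_zero_le (h : ∀ n k, β (n + k) k ≤ ∑ i ∈ Finset.range (k + 1), β n i * ε (k - i))
    (hβ : ∀ n k, n < k → β n k = 0) (J : ℕ) :
    arraySeries β x 0 ≤
      arraySeries β x J * ∏ i ∈ Finset.range J, ∑' m, ε m * (x ^ (i + 1)) ^ m := by
  induction J with
  | zero => simp
  | succ J ih =>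
    refine ih.trans ?_
    rw [Finset.prod_range_succ, mul_comm (∏ i ∈ _, _), ← mul_assoc]
    gcongr
    rw [arraySeries_mul, arraySeries_shift β hβ]
    exact ENNReal.tsum_le_tsum fun k => ENNReal.tsum_le_tsum fun n => by gcongr; exact h n k

theorem le_arraySeries_zero (h : ∀ n k, ∑ i ∈ Finset.range (k + 1), β n i * ε (k - i) ≤ β (n + k) k)
    (hβ : ∀ n k, n < k → β n k = 0) (J : ℕ) :
    arraySeries β x J * ∏ i ∈ Finset.range J, ∑' m, ε m * (x ^ (i + 1)) ^ m ≤
      arraySeries β x 0 := by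
  induction J with
  | zero => simp
  | succ J ih =>
    refine le_trans ?_ ih
    rw [Finset.prod_range_succ, mul_comm (∏ i ∈ _, _), ← mul_assoc]
    gcongr
    rw [arraySeries_mul, arraySeries_shift β hβ]
    exact ENNReal.tsum_le_tsum fun k => ENNReal.tsum_le_tsum fun n => by gcongr; exact h n k

/-- Solution of the corank recursion. -/
theorem arraySeries_zero_eq (hx : x < 1)
    (h : ∀ n k, β (n + k) k = ∑ i ∈ Finset.range (k + 1), β n i * ε (k - i))
    (hβ : ∀ n k, n < k → β n k = 0) (hfin : ∀ n k, β n k ≠ ⊤)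
    (hε : ⨆ J, ∏ i ∈ Finset.range J, ∑' m, ε m * (x ^ (i + 1)) ^ m ≠ ⊤) :
    arraySeries β x 0 = (∑' n, β n 0 * x ^ n) *
      ⨆ J, ∏ i ∈ Finset.range J, ∑' m, ε m * (x ^ (i + 1)) ^ m := by
  set G := ⨆ J, ∏ i ∈ Finset.range J, ∑' m, ε m * (x ^ (i + 1)) ^ m with hG
  have hle (J : ℕ) : ∏ i ∈ Finset.range J, ∑' m, ε m * (x ^ (i + 1)) ^ m ≤ G :=
    le_iSup (fun J => ∏ i ∈ Finset.range J, ∑' m, ε m * (x ^ (i + 1)) ^ m) J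
  apply le_antisymm
  -- The limit `J → ∞` needs `arraySeries _ x 0` to be finite, which is not known for `β`. Cutting
  -- off at `n < N` leaves a finite sum; the supremum over `N` is taken at the end.
  · let γ (N n k : ℕ) : ℝ≥0∞ := if n < N then β n k else 0
    have hγβ (N n k) : γ N n k ≤ β n k := by
      simp only [γ]; split_ifs <;> simp
    have hγfin (N : ℕ) : arraySeries (γ N) x 0 ≠ ⊤ := by
      have h1 (k n : ℕ) (hn : n ∉ Finset.range N) : γ N n k * x ^ (n + 0 * k) = 0 := by
        simp only [γ]; rw [if_neg (by simpa using hn), zero_mul]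
      have h2 (k : ℕ) (hk : k ∉ Finset.range N) :
          ∑ n ∈ Finset.range N, γ N n k * x ^ (n + 0 * k) = 0 := by
        refine Finset.sum_eq_zero fun n hn => ?_
        simp only [Finset.mem_range] at hk hn
        simp only [γ]
        rw [hβ n k (by omega), ite_self, zero_mul]
      have h3 : arraySeries (γ N) x 0 =
          ∑ k ∈ Finset.range N, ∑ n ∈ Finset.range N, γ N n k * x ^ (n + 0 * k) := by
        rw [arraySeries]
        exact (tsum_congr fun k => tsum_eq_sum fun n hn => h1 k n hn).trans
          (tsum_eq_sum fun k hk => h2 k hk)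
      rw [h3]
      refine ENNReal.sum_ne_top.2 fun k _ => ENNReal.sum_ne_top.2 fun n _ => ENNReal.mul_ne_top ?_
        (ENNReal.pow_ne_top (hx.trans ENNReal.one_lt_top).ne)
      exact ne_top_of_le_ne_top (hfin n k) (hγβ N n k)
    have hmain (N : ℕ) : arraySeries (γ N) x 0 ≤ (∑' n, β n 0 * x ^ n) * G := by
      -- Every term with corank at least one carries a factor `x ^ J`, so only corank zero survives
      -- in the limit.
      have h1 (J : ℕ) : arraySeries (γ N) x J ≤ (∑' n, β n 0 * x ^ n) +
          x ^ J * arraySeries (γ N) x 0 := by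
        rw [arraySeries, tsum_eq_zero_add' ENNReal.summable]
        refine add_le_add ?_ ?_
        · refine ENNReal.tsum_le_tsum fun n => ?_
          rw [mul_zero, add_zero]
          gcongr
          exact hγβ N n 0
        · rw [arraySeries, ← ENNReal.tsum_mul_left]
          refine le_trans ?_ (ENNReal.tsum_comp_le_tsum_of_injective (add_left_injective 1)
            (fun k => x ^ J * ∑' n, γ N n k * x ^ (n + 0 * k)))
          refine ENNReal.tsum_le_tsum fun k => ?_
          rw [← ENNReal.tsum_mul_left]
          refine ENNReal.tsum_le_tsum fun n => ?_
          rw [mul_left_comm, ← pow_add]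
          refine mul_le_mul' le_rfl (pow_le_pow_of_le_one zero_le hx.le ?_)
          have := Nat.le_mul_of_pos_right J k.add_one_pos
          omega
      have h2 (J : ℕ) : arraySeries (γ N) x 0 ≤ ((∑' n, β n 0 * x ^ n) +
          x ^ J * arraySeries (γ N) x 0) * G := by
        refine (arraySeries_zero_le (γ N) ε x (fun n k => ?_) (fun n k hnk => ?_) J).trans
          (mul_le_mul' (h1 J) (hle J))
        · simp only [γ]
          by_cases hN : n + k < N
          · simp [hN, show n < N by omega, h]
          · simp [hN]
        · simp only [γ]
          rw [hβ n k hnk, ite_self]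
      have h3 : Tendsto (fun J : ℕ => ((∑' n, β n 0 * x ^ n) +
          x ^ J * arraySeries (γ N) x 0) * G) atTop (𝓝 (((∑' n, β n 0 * x ^ n) +
          0 * arraySeries (γ N) x 0) * G)) := by
        refine ENNReal.Tendsto.mul_const (tendsto_const_nhds.add (ENNReal.Tendsto.mul_const
          (ENNReal.tendsto_pow_atTop_nhds_zero_of_lt_one hx) (.inr (hγfin N)))) (.inr hε)
      rw [zero_mul, add_zero] at h3
      exact ge_of_tendsto' h3 h2
    have hsup : arraySeries β x 0 ≤ ⨆ N, arraySeries (γ N) x 0 := by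
      rw [arraySeries, ENNReal.tsum_comm, ENNReal.tsum_eq_iSup_nat]
      refine iSup_mono fun N => ?_
      rw [arraySeries, ENNReal.tsum_comm]
      refine le_trans (le_of_eq ?_) (ENNReal.sum_le_tsum (Finset.range N))
      refine Finset.sum_congr rfl fun n hn => tsum_congr fun k => ?_
      simp only [γ]
      rw [if_pos (Finset.mem_range.1 hn)]
    exact hsup.trans (iSup_le hmain)
  -- For the lower bound it suffices to keep the corank zero terms of level `J`.
  · rw [hG, ENNReal.mul_iSup]
    refine iSup_le fun J => le_trans ?_ (le_arraySeries_zero β ε x (fun n k => (h n k).ge) hβ J)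
    gcongr
    rw [arraySeries]
    refine le_trans (le_of_eq ?_) (ENNReal.le_tsum 0)
    simp

end CorankSeries

/-! ### The Feit–Fine generating function -/

section RealSeries

open scoped ENNReal Topology

theorem norm_one_div_one_sub_sub_one_le {𝕜 : Type*} [NormedField 𝕜] {a : 𝕜} (h : ‖a‖ ≤ 1 / 2) :
    ‖1 / (1 - a) - 1‖ ≤ 2 * ‖a‖ := by
  have h1 : 1 / 2 ≤ ‖1 - a‖ := by
    have := norm_sub_norm_le 1 a
    rw [norm_one] at this
    linarith
  have h2 : 1 - a ≠ 0 := norm_pos_iff.1 (by linarith)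
  rw [show 1 / (1 - a) - 1 = a / (1 - a) by field_simp; ring, norm_div, div_le_iff₀ (by linarith)]
  nlinarith [norm_nonneg a]

theorem summable_norm_one_div_one_sub {𝕜 ι : Type*} [NormedField 𝕜] {a : ι → 𝕜}
    (h : Summable fun i => ‖a i‖) : Summable fun i => ‖1 / (1 - a i) - 1‖ := by
  refine Summable.of_norm_bounded_eventually (h.mul_left 2) ?_
  have h1 : ∀ᶠ i in cofinite, ‖a i‖ < 1 / 2 :=
    h.tendsto_cofinite_zero.eventually_lt_const (by norm_num)
  filter_upwards [h1] with i hi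
  rw [norm_norm]
  exact norm_one_div_one_sub_sub_one_le hi.le

theorem multipliable_one_div_one_sub {𝕜 ι : Type*} [NormedField 𝕜] [CompleteSpace 𝕜] {a : ι → 𝕜}
    (h : Summable fun i => ‖a i‖) : Multipliable fun i => 1 / (1 - a i) := by
  have h1 := multipliable_one_add_of_summable (R := 𝕜) (f := fun i => 1 / (1 - a i) - 1)
    (summable_norm_one_div_one_sub h)
  exact h1.congr fun i => add_sub_cancel _ _

theorem iSup_prod_ofReal {u : ℕ → ℝ} (hu : ∀ i, 1 ≤ u i) (hm : Multipliable u) :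
    ⨆ L, ∏ i ∈ Finset.range L, ENNReal.ofReal (u i) = ENNReal.ofReal (∏' i, u i) := by
  have h1 : Monotone fun L => ∏ i ∈ Finset.range L, ENNReal.ofReal (u i) := by
    refine monotone_nat_of_le_succ fun L => ?_
    rw [Finset.prod_range_succ]
    exact le_mul_of_one_le_right' (by simpa using hu L)
  refine tendsto_nhds_unique (tendsto_atTop_iSup h1) ?_
  have h2 := (ENNReal.continuous_ofReal.tendsto _).comp hm.hasProd.tendsto_prod_nat
  refine h2.congr fun L => ?_
  exact ENNReal.ofReal_prod_of_nonneg fun i _ => zero_le_one.trans (hu i)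

theorem one_le_one_div_one_sub {u : ℝ} (h0 : 0 ≤ u) (h1 : u < 1) : 1 ≤ 1 / (1 - u) := by
  rw [le_div_iff₀ (by linarith)]
  linarith

theorem inv_one_sub_ofReal {u : ℝ} (h0 : 0 ≤ u) (h1 : u < 1) :
    (1 - ENNReal.ofReal u)⁻¹ = ENNReal.ofReal (1 / (1 - u)) := by
  rw [← ENNReal.ofReal_one, ← ENNReal.ofReal_sub _ h0, ← ENNReal.ofReal_inv_of_pos (by linarith),
    one_div]

/-- A finite value of the extended sum already implies summability, so convergence of the pair
series is obtained together with its value. -/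
theorem hasSum_of_tsum_ofReal {g : ℕ → ℝ} {S : ℝ} (hg : ∀ n, 0 ≤ g n) (hS : 0 ≤ S)
    (h : ∑' n, ENNReal.ofReal (g n) = ENNReal.ofReal S) : HasSum g S := by
  have h1 : Summable g := by
    have := ENNReal.summable_toReal (h.trans_ne ENNReal.ofReal_ne_top)
    simpa only [ENNReal.toReal_ofReal (hg _)] using this
  have h2 := (ENNReal.ofReal_tsum_of_nonneg hg h1).trans h
  rw [ENNReal.ofReal_eq_ofReal_iff (tsum_nonneg hg) hS] at h2
  exact h2 ▸ h1.hasSum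

variable {q : ℝ}

theorem summable_euler (hq : 1 < q) {t : ℝ} (ht0 : 0 < t) (ht : t < 1) :
    Summable fun m => t ^ m / f q m := by
  have hf (m) := f_pos hq m
  refine summable_of_ratio_test_tendsto_lt_one ht
    (.of_forall fun m => (div_pos (pow_pos ht0 m) (hf m)).ne') ?_
  have h1 : Tendsto (fun m : ℕ => t / (1 - (q ^ (m + 1))⁻¹)) atTop (𝓝 (t / (1 - 0))) := by
    refine tendsto_const_nhds.div (tendsto_const_nhds.sub ?_) (by norm_num)
    exact ((tendsto_pow_atTop_atTop_of_one_lt hq).comp (tendsto_add_atTop_nat 1)).inv_tendsto_atTop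
  rw [sub_zero, div_one] at h1
  refine h1.congr fun m => ?_
  rw [Real.norm_of_nonneg (div_pos (pow_pos ht0 _) (hf _)).le,
    Real.norm_of_nonneg (div_pos (pow_pos ht0 _) (hf _)).le, f_succ, pow_succ t]
  have h2 : (1 - (q ^ (m + 1))⁻¹) ≠ 0 := by
    intro h
    have := hf (m + 1)
    rw [f_succ, h, mul_zero] at this
    exact this.false
  have := (hf m).ne'
  field_simp

/-- Euler's product for the series with coefficients `1 / f q m`. -/
theorem tsum_euler (hq : 1 < q) {t : ℝ} (ht0 : 0 < t) (ht : t < 1) :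
    ∑' m, t ^ m / f q m = ∏' j : ℕ, 1 / (1 - (q ^ j)⁻¹ * t) := by
  have hq0 : 0 < q := by linarith
  have hf (m) := f_pos hq m
  have hqj (j : ℕ) : (q ^ j)⁻¹ ≤ 1 := inv_le_one_of_one_le₀ (one_le_pow₀ hq.le)
  have hqj0 (j : ℕ) : 0 < (q ^ j)⁻¹ := by positivity
  -- The functional equation `E(s) = E(s / q) / (1 - s)`, from `f (m + 1) = f m * (1 - q ^ (-(m +
  -- 1)))`.
  have hstep (s : ℝ) (hs0 : 0 < s) (hs : s < 1) :
      ∑' m, s ^ m / f q m = 1 / (1 - s) * ∑' m, (q⁻¹ * s) ^ m / f q m := by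
    have h1 := summable_euler hq hs0 hs
    have hs' : q⁻¹ * s < 1 := by
      have := hqj 1
      rw [pow_one] at this
      nlinarith
    have h2 := summable_euler hq (t := q⁻¹ * s) (by positivity) hs'
    have h3 : ∑' m, (q⁻¹ * s) ^ m / f q m = ∑' m, s ^ m / f q m - s * ∑' m, s ^ m / f q m := by
      rw [h2.tsum_eq_zero_add, h1.tsum_eq_zero_add]
      nth_rewrite 2 [← h1.tsum_eq_zero_add]
      rw [← tsum_mul_left, add_sub_assoc,
        ← ((summable_nat_add_iff 1).2 h1).tsum_sub (h1.mul_left s)]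
      rw [pow_zero, pow_zero]
      congr 1
      refine tsum_congr fun m => ?_
      have h4 := hf (m + 1)
      have h5 := (hf m).ne'
      rw [f_succ] at h4 ⊢
      have h6 : (1 - (q ^ (m + 1))⁻¹) ≠ 0 := by
        intro h
        rw [h, mul_zero] at h4
        exact h4.false
      rw [mul_pow, inv_pow, pow_succ s]
      have h7 : q ^ (m + 1) ≠ 0 := by positivity
      generalize (q ^ (m + 1))⁻¹ = z at *
      field_simp
      ring
    rw [h3]
    have : 1 - s ≠ 0 := by linarith
    field_simp
  have hiter (J : ℕ) : ∑' m, t ^ m / f q m =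
      (∏ j ∈ Finset.range J, 1 / (1 - (q ^ j)⁻¹ * t)) * ∑' m, ((q ^ J)⁻¹ * t) ^ m / f q m := by
    induction J with
    | zero => simp
    | succ J ih =>
      rw [ih, Finset.prod_range_succ, hstep ((q ^ J)⁻¹ * t) (by positivity) (by nlinarith [hqj J]),
        mul_assoc, ← mul_assoc q⁻¹, ← mul_inv, ← pow_succ']
  -- By dominated convergence `E(q ^ (-J) t)` tends to its constant term.
  have hlim : Tendsto (fun J : ℕ => ∑' m, ((q ^ J)⁻¹ * t) ^ m / f q m) atTop
      (𝓝 (∑' m, if m = 0 then 1 else 0)) := by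
    refine tendsto_tsum_of_dominated_convergence (summable_euler hq ht0 ht) (fun m => ?_)
      (.of_forall fun J m => ?_)
    · have h1 : Tendsto (fun J : ℕ => ((q ^ J)⁻¹ * t) ^ m / f q m) atTop
          (𝓝 ((0 * t) ^ m / f q m)) :=
        (((tendsto_pow_atTop_atTop_of_one_lt hq).inv_tendsto_atTop.mul_const t).pow m).div_const _
      rcases eq_or_ne m 0 with rfl | hm
      · simp [f]
      · simpa [hm] using h1
    · rw [Real.norm_of_nonneg (by have := hf m; have := hqj0 J; positivity)]
      have := hf m
      gcongr
      nlinarith [hqj J]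
  rw [tsum_ite_eq] at hlim
  have hmul : Multipliable fun j : ℕ => 1 / (1 - (q ^ j)⁻¹ * t) := by
    refine multipliable_one_div_one_sub ?_
    have := (summable_geometric_of_lt_one (by positivity) (inv_lt_one_of_one_lt₀ hq)).mul_right t
    refine this.congr fun j => ?_
    rw [Real.norm_of_nonneg (by positivity), inv_pow]
  have h2 := hmul.hasProd.tendsto_prod_nat.mul hlim
  rw [mul_one] at h2
  exact tendsto_nhds_unique (tendsto_const_nhds.congr hiter) h2

theorem summable_double (hq : 1 < q) {x : ℝ} (hx0 : 0 ≤ x) (hx : x < 1) :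
    Summable fun k : ℕ × ℕ => ‖(q ^ k.2)⁻¹ * x ^ (k.1 + 1)‖ := by
  have h1 := (summable_geometric_of_lt_one hx0 hx).mul_left x
  have h2 := summable_geometric_of_lt_one (inv_nonneg.2 (by linarith)) (inv_lt_one_of_one_lt₀ hq)
  refine (h1.mul_of_nonneg h2 (fun n => by positivity) fun n => ?_).congr fun k => ?_
  · have : 0 < q := by linarith
    positivity
  · have : 0 < q := by linarith
    rw [Real.norm_of_nonneg (by positivity), pow_succ', inv_pow, mul_comm]

variable (K : Type*) [Field K] [Finite K]

/-- The number of commuting pairs divided by the order of the general linear group. -/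
def totalDensity (n : ℕ) : ℝ := ∑ k ∈ Finset.range (n + 1), pairDensity K n k

theorem pairDensity_nonneg (n k : ℕ) : 0 ≤ pairDensity K n k := by
  unfold pairDensity; positivity

theorem pairDensity_eq_zero {n k : ℕ} (h : n < k) : pairDensity K n k = 0 := by
  rw [pairDensity, corankCount_eq_zero (by simpa using h)]
  simp

/-- The generating function of commuting pairs, for small positive arguments. -/
theorem hasSum_totalDensity {x : ℝ} (hx0 : 0 < x) (hx : Nat.card K * x < 1) :
    HasSum (fun n => totalDensity K n * x ^ n)
      ((∏' e : ℕ, 1 / (1 - Nat.card K * x ^ (e + 1))) *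
        ∏' k : ℕ × ℕ, 1 / (1 - ((Nat.card K : ℝ) ^ k.2)⁻¹ * x ^ (k.1 + 1))) := by
  have hq : (1 : ℝ) < Nat.card K := by exact_mod_cast one_lt_card K
  set q : ℝ := (Nat.card K : ℝ) with hqdef
  have hq0 : 0 < q := by linarith
  have hx1 : x < 1 := by nlinarith
  have hxp (i : ℕ) : x ^ (i + 1) ≤ x := by
    rw [pow_succ]
    exact mul_le_of_le_one_left hx0.le (pow_le_one₀ hx0.le hx1.le)
  have hu0 (e : ℕ) : 0 ≤ q * x ^ (e + 1) := by positivity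
  have hu1 (e : ℕ) : q * x ^ (e + 1) < 1 := by nlinarith [hxp e]
  have hv0 (k : ℕ × ℕ) : 0 ≤ (q ^ k.2)⁻¹ * x ^ (k.1 + 1) := by positivity
  have hv1 (k : ℕ × ℕ) : (q ^ k.2)⁻¹ * x ^ (k.1 + 1) < 1 := by
    have h1 : (q ^ k.2)⁻¹ ≤ 1 := inv_le_one_of_one_le₀ (one_le_pow₀ hq.le)
    have h2 : 0 < (q ^ k.2)⁻¹ := by positivity
    have h3 := hxp k.1
    have h4 : 0 < x ^ (k.1 + 1) := by positivity
    nlinarith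
  have hsum := summable_double hq hx0.le hx1
  have hm1 : Multipliable fun e : ℕ => 1 / (1 - q * x ^ (e + 1)) := by
    refine multipliable_one_div_one_sub ?_
    refine ((summable_geometric_of_lt_one hx0.le hx1).mul_left (q * x)).congr fun e => ?_
    rw [Real.norm_of_nonneg (hu0 e), pow_succ', mul_assoc]
  have hm2 := multipliable_one_div_one_sub hsum
  have hm3 (i : ℕ) : Multipliable fun j : ℕ => 1 / (1 - (q ^ j)⁻¹ * x ^ (i + 1)) :=
    multipliable_one_div_one_sub (hsum.prod_factor i)
  have hE (i : ℕ) : ∑' m, ENNReal.ofReal (1 / f q m) * (ENNReal.ofReal x ^ (i + 1)) ^ m =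
      ENNReal.ofReal (∏' j : ℕ, 1 / (1 - (q ^ j)⁻¹ * x ^ (i + 1))) := by
    rw [← tsum_euler hq (by positivity) ((hxp i).trans_lt hx1), ENNReal.ofReal_tsum_of_nonneg
      (fun m => by have := f_pos hq m; positivity)
      (summable_euler hq (by positivity) ((hxp i).trans_lt hx1))]
    refine tsum_congr fun m => ?_
    have := f_pos hq m
    rw [← ENNReal.ofReal_pow hx0.le, ← ENNReal.ofReal_pow (by positivity),
      ← ENNReal.ofReal_mul (by positivity), one_div, div_eq_inv_mul]
  have hE1 (i : ℕ) : 1 ≤ ∏' j : ℕ, 1 / (1 - (q ^ j)⁻¹ * x ^ (i + 1)) :=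
    ge_of_tendsto' (hm3 i).hasProd.tendsto_prod_nat fun L =>
      Finset.prod_induction _ (1 ≤ ·) (fun _ _ => one_le_mul_of_one_le_of_one_le) le_rfl
        fun j _ => one_le_one_div_one_sub (hv0 (i, j)) (hv1 (i, j))
  have hm4 : Multipliable fun i : ℕ => ∏' j : ℕ, 1 / (1 - (q ^ j)⁻¹ * x ^ (i + 1)) :=
    (hm2.hasProd.prod_fiberwise fun i => (hm3 i).hasProd).multipliable
  have hG : ⨆ J, ∏ i ∈ Finset.range J,
      ∑' m, ENNReal.ofReal (1 / f q m) * (ENNReal.ofReal x ^ (i + 1)) ^ m =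
      ENNReal.ofReal (∏' k : ℕ × ℕ, 1 / (1 - (q ^ k.2)⁻¹ * x ^ (k.1 + 1))) := by
    simp_rw [hE]
    rw [iSup_prod_ofReal hE1 hm4, hm2.tprod_prod' hm3]
  have hB : ∑' n, ENNReal.ofReal (pairDensity K n 0) * ENNReal.ofReal x ^ n =
      ENNReal.ofReal (∏' e : ℕ, 1 / (1 - q * x ^ (e + 1))) := by
    rw [← iSup_prod_ofReal (fun e => one_le_one_div_one_sub (hu0 e) (hu1 e)) hm1]
    have h1 := tsum_classCount K (ENNReal.ofReal x)
    simp_rw [pairDensity_zero, ENNReal.ofReal_natCast]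
    rw [h1]
    refine iSup_congr fun L => Finset.prod_congr rfl fun e _ => ?_
    rw [← inv_one_sub_ofReal (hu0 e) (hu1 e), ENNReal.ofReal_mul hq0.le, ENNReal.ofReal_pow hx0.le,
      hqdef, ENNReal.ofReal_natCast]
  -- The kernel is `1 / f`, so its series is Euler's and the factor from the recursion is the double
  -- product.
  have hmain := arraySeries_zero_eq (fun n k => ENNReal.ofReal (pairDensity K n k))
    (fun m => ENNReal.ofReal (1 / f q m)) (ENNReal.ofReal x) (by simpa using hx1)
    (fun n k => by
      rw [pairDensity_add, ENNReal.ofReal_sum_of_nonneg fun i _ =>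
        div_nonneg (pairDensity_nonneg K _ _) (f_pos hq _).le]
      refine Finset.sum_congr rfl fun i _ => ?_
      rw [← ENNReal.ofReal_mul (pairDensity_nonneg K _ _), mul_one_div])
    (fun n k h => by simp only [pairDensity_eq_zero K h, ENNReal.ofReal_zero])
    (fun n k => ENNReal.ofReal_ne_top) (by rw [hG]; exact ENNReal.ofReal_ne_top)
  have hP1 : 0 ≤ ∏' e : ℕ, 1 / (1 - q * x ^ (e + 1)) :=
    ge_of_tendsto' hm1.hasProd.tendsto_prod_nat fun L =>
      Finset.prod_nonneg fun j _ => one_div_nonneg.2 (by linarith [hu1 j])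
  have hP2 : 0 ≤ ∏' k : ℕ × ℕ, 1 / (1 - (q ^ k.2)⁻¹ * x ^ (k.1 + 1)) :=
    ge_of_tendsto' hm2.hasProd fun L =>
      Finset.prod_nonneg fun j _ => one_div_nonneg.2 (by linarith [hv1 j])
  rw [hG, hB, ← ENNReal.ofReal_mul hP1] at hmain
  have htot (n : ℕ) : 0 ≤ totalDensity K n := Finset.sum_nonneg fun k _ => pairDensity_nonneg K n k
  refine hasSum_of_tsum_ofReal (fun n => mul_nonneg (htot n) (by positivity))
    (mul_nonneg hP1 hP2) ?_
  rw [← hmain, arraySeries, ENNReal.tsum_comm]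
  refine tsum_congr fun n => ?_
  rw [tsum_eq_sum (s := Finset.range (n + 1)) fun k hk => by
    rw [pairDensity_eq_zero K (by simpa using hk), ENNReal.ofReal_zero, zero_mul]]
  simp_rw [zero_mul, add_zero]
  rw [← Finset.sum_mul, ← ENNReal.ofReal_sum_of_nonneg fun k _ => pairDensity_nonneg K n k,
    ENNReal.ofReal_mul (htot n), ENNReal.ofReal_pow hx0.le]
  rfl

end RealSeries

/-! ### Coefficient asymptotics from simple poles -/

section Peeling

open scoped Topology

/-- Zeros are divided out one at a time with `dslope`, which stays holomorphic across the removed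
point. -/
theorem exists_eq_prod_mul {U : Set ℂ} (hU : IsOpen U) (S : Finset ℂ) (hS : ∀ s ∈ S, s ∈ U) {A : ℂ → ℂ}
    (hA : DifferentiableOn ℂ A U) (h0 : ∀ s ∈ S, A s = 0) :
    ∃ H : ℂ → ℂ, DifferentiableOn ℂ H U ∧ ∀ w, A w = (∏ s ∈ S, (w - s)) * H w := by
  induction S using Finset.induction_on generalizing A with
  | empty => exact ⟨A, hA, by simp⟩
  | insert s S hs ih =>
    have hsU := hU.mem_nhds (hS s (Finset.mem_insert_self s S))
    have hslope (w : ℂ) : A w = (w - s) * dslope A s w := by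
      have := sub_smul_dslope A s w
      rw [h0 s (Finset.mem_insert_self s S), sub_zero, smul_eq_mul] at this
      exact this.symm
    obtain ⟨H, hH, hAH⟩ := ih (fun t ht => hS t (Finset.mem_insert_of_mem ht))
      ((Complex.differentiableOn_dslope hsU).2 hA) (fun t ht => by
        have h1 := hslope t
        rw [h0 t (Finset.mem_insert_of_mem ht)] at h1
        have h2 : t - s ≠ 0 := sub_ne_zero.2 fun h => hs (h ▸ ht)
        exact (mul_eq_zero.1 h1.symm).resolve_left h2)
    exact ⟨H, hH, fun w => by rw [hslope, hAH, Finset.prod_insert hs, mul_assoc]⟩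

/-- Partial fractions: subtracting the principal parts at simple poles. -/
theorem exists_eq_sum_add {U : Set ℂ} (hU : IsOpen U) (S : Finset ℂ) (hS : ∀ s ∈ S, s ∈ U)
    (hS0 : ∀ s ∈ S, s ≠ 0) {A : ℂ → ℂ} (hA : DifferentiableOn ℂ A U) (c : ℂ → ℂ)
    (hc : ∀ s ∈ S, A s = c s * ∏ t ∈ S.erase s, (1 - s / t)) :
    ∃ H : ℂ → ℂ, DifferentiableOn ℂ H U ∧ ∀ w, w ∉ S →
      A w / ∏ s ∈ S, (1 - w / s) = (∑ s ∈ S, c s / (1 - w / s)) + H w := by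
  -- The Lagrange interpolant of `A` at the points of `S` is subtracted; by `hc` the difference
  -- vanishes on `S`.
  obtain ⟨H, hH, hAH⟩ := exists_eq_prod_mul hU S hS
    (A := fun w => A w - ∑ s ∈ S, c s * ∏ t ∈ S.erase s, (1 - w / t))
    (hA.sub (by fun_prop)) (fun s hs => by
      rw [Finset.sum_eq_single s, hc s hs, sub_self]
      · intro t ht hts
        rw [Finset.prod_eq_zero (i := s), mul_zero]
        · exact Finset.mem_erase.2 ⟨hts.symm, hs⟩
        · rw [div_self (hS0 s hs), sub_self]
      · exact fun h => absurd hs h)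
  refine ⟨fun w => (∏ s ∈ S, (-s)) * H w, hH.const_mul _, fun w hw => ?_⟩
  have hne (s : ℂ) (hs : s ∈ S) : 1 - w / s ≠ 0 := by
    rw [sub_ne_zero, ne_comm, Ne, div_eq_one_iff_eq (hS0 s hs)]
    rintro rfl
    exact hw hs
  have hprod : ∏ s ∈ S, (1 - w / s) ≠ 0 := Finset.prod_ne_zero_iff.2 hne
  have h1 : (∏ s ∈ S, (w - s)) = (∏ s ∈ S, (1 - w / s)) * ∏ s ∈ S, (-s) := by
    rw [← Finset.prod_mul_distrib]
    refine Finset.prod_congr rfl fun s hs => ?_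
    have := hS0 s hs
    field_simp
    ring
  have h2 : ∑ s ∈ S, c s * ∏ t ∈ S.erase s, (1 - w / t) =
      (∏ s ∈ S, (1 - w / s)) * ∑ s ∈ S, c s / (1 - w / s) := by
    rw [Finset.mul_sum]
    refine Finset.sum_congr rfl fun s hs => ?_
    rw [← Finset.mul_prod_erase S _ hs]
    have := hne s hs
    field_simp
  rw [div_eq_iff hprod]
  have h3 := hAH w
  rw [h1, h2, sub_eq_iff_eq_add] at h3
  rw [h3]
  ring

/-- A power series vanishing on a real interval is zero. -/
theorem eq_zero_of_hasSum_zero {d : ℕ → ℂ} {δ : ℝ} (hδ : 0 < δ)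
    (h : ∀ x : ℝ, 0 < x → x < δ → HasSum (fun n => d n * (x : ℂ) ^ n) 0) : d = 0 := by
  let p := FormalMultilinearSeries.ofScalars ℂ d
  have hp (n : ℕ) (z : ℂ) : (p n fun _ => z) = d n * z ^ n := by
    simp [p, FormalMultilinearSeries.ofScalars]
  have hrad : 0 < p.radius := by
    have h1 := (h (δ / 2) (by linarith) (by linarith)).summable.tendsto_atTop_zero.norm
    have h2 := p.le_radius_of_tendsto (r := Real.toNNReal (δ / 2)) (l := ‖(0 : ℂ)‖) (by
      refine h1.congr fun n => ?_
      rw [FormalMultilinearSeries.ofScalars_norm, norm_mul, norm_pow, Complex.norm_real,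
        Real.norm_of_nonneg (by linarith), Real.coe_toNNReal _ (by linarith)])
    exact lt_of_lt_of_le (ENNReal.coe_pos.2 (Real.toNNReal_pos.2 (by linarith))) h2
  have hball := p.hasFPowerSeriesOnBall hrad
  have hfreq : ∃ᶠ z in 𝓝[≠] (0 : ℂ), p.sum z = 0 := by
    have h1 : Tendsto (fun x : ℝ => (x : ℂ)) (𝓝[>] 0) (𝓝[≠] 0) := by
      refine tendsto_nhdsWithin_of_tendsto_nhds_of_eventually_within _ ?_ ?_
      · exact (Complex.continuous_ofReal.tendsto' 0 0 rfl).mono_left nhdsWithin_le_nhds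
      · filter_upwards [self_mem_nhdsWithin] with x hx
        simpa using (ne_of_gt hx)
    refine h1.frequently (Eventually.frequently ?_)
    filter_upwards [Ioo_mem_nhdsGT hδ] with x hx
    have h2 := h x hx.1 hx.2
    rw [FormalMultilinearSeries.sum]
    simp_rw [hp]
    exact h2.tsum_eq
  have hzero := hball.analyticAt.frequently_zero_iff_eventually_zero.1 hfreq
  have hp0 : p = 0 := (hball.hasFPowerSeriesAt.congr hzero).eq_zero
  funext n
  exact (FormalMultilinearSeries.ofScalars_eq_zero ℂ n).1 (congrFun hp0 n)

/-- Asymptotics of power series coefficients from simple poles. -/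
theorem coeff_isBigO_of_simple_poles {b : ℕ → ℂ} {R : ℝ} {S : Finset ℂ}
    (hS : ∀ s ∈ S, s ∈ Metric.ball (0 : ℂ) R) (hS0 : ∀ s ∈ S, s ≠ 0) {A : ℂ → ℂ}
    (hA : DifferentiableOn ℂ A (Metric.ball 0 R)) {c : ℂ → ℂ}
    (hc : ∀ s ∈ S, A s = c s * ∏ t ∈ S.erase s, (1 - s / t)) {δ : ℝ} (hδ : 0 < δ)
    (hb : ∀ x : ℝ, 0 < x → x < δ →
      HasSum (fun n => b n * (x : ℂ) ^ n) (A x / ∏ s ∈ S, (1 - x / s)))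
    {ρ : ℝ} (hρ0 : 0 < ρ) (hρ : ρ < R) :
    (fun n => b n - ∑ s ∈ S, c s * (s⁻¹) ^ n) =O[atTop] fun n => (ρ⁻¹) ^ n := by
  obtain ⟨H, hH, hAH⟩ := exists_eq_sum_add Metric.isOpen_ball S hS hS0 hA c hc
  let e : ℕ → ℂ := fun n => (n.factorial : ℂ)⁻¹ * iteratedDeriv n H 0
  have he (z : ℂ) (hz : z ∈ Metric.ball (0 : ℂ) R) : HasSum (fun n => e n * z ^ n) (H z) := by
    refine (Complex.hasSum_taylorSeries_on_ball hH hz).congr_fun ?_ |> id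
    intro n
    simp [e]
    ring
  obtain ⟨η, hη0, hη⟩ : ∃ η : ℝ, 0 < η ∧ ∀ s ∈ S, η ≤ ‖s‖ := by
    rcases S.eq_empty_or_nonempty with rfl | hne
    · exact ⟨1, one_pos, by simp⟩
    · obtain ⟨s, hs, hmin⟩ := S.exists_min_image (fun s => ‖s‖) hne
      exact ⟨‖s‖, norm_pos_iff.2 (hS0 s hs), hmin⟩
  -- Both series represent the same function for small positive `x`, below `δ`, `R` and every `‖s‖`,
  -- so the coefficients agree.
  have hd : (fun n => b n - ((∑ s ∈ S, c s * (s⁻¹) ^ n) + e n)) = 0 := by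
    refine eq_zero_of_hasSum_zero (δ := min δ (min η R))
      (lt_min hδ (lt_min hη0 (hρ0.trans hρ))) fun x hx0 hx => ?_
    have hx1 := hx.trans_le (min_le_left _ _)
    have hx2 := hx.trans_le ((min_le_right _ _).trans (min_le_left _ _))
    have hx3 := hx.trans_le ((min_le_right _ _).trans (min_le_right _ _))
    have hxn : ‖(x : ℂ)‖ = x := by rw [Complex.norm_real, Real.norm_of_nonneg hx0.le]
    have hgeo (s : ℂ) (hs : s ∈ S) :
        HasSum (fun n => c s * (s⁻¹) ^ n * (x : ℂ) ^ n) (c s / (1 - x / s)) := by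
      have h1 : ‖(x : ℂ) / s‖ < 1 := by
        rw [norm_div, hxn, div_lt_one (norm_pos_iff.2 (hS0 s hs))]
        exact hx2.trans_le (hη s hs)
      refine ((hasSum_geometric_of_norm_lt_one h1).mul_left (c s)).congr_fun ?_ |> id
      intro n
      rw [div_pow, inv_pow]
      ring
    have hxS : (x : ℂ) ∉ S := fun h => by
      have := hη _ h
      rw [hxn] at this
      linarith
    have h1 := (hb x hx0 hx1).sub ((hasSum_sum hgeo).add (he x (by simpa [abs_of_pos hx0] using hx3)))
    rw [hAH x hxS, sub_self] at h1
    refine h1.congr_fun ?_ |> id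
    intro n
    rw [sub_mul, add_mul, Finset.sum_mul]
  have hbe (n : ℕ) : b n - ∑ s ∈ S, c s * (s⁻¹) ^ n = e n := by
    have := congrFun hd n
    simp only [Pi.zero_apply] at this
    linear_combination this
  simp_rw [hbe]
  -- Convergence at `ρ < R` alone makes `e n * ρ ^ n` bounded.
  have h1 := (he (ρ : ℂ) (by simpa [abs_of_pos hρ0] using hρ)).summable.tendsto_atTop_zero
  have h2 : (fun n => e n * (ρ : ℂ) ^ n) =O[atTop] fun _ => (1 : ℝ) := h1.isBigO_one ℝ
  have h3 : (fun n => (ρ⁻¹ : ℝ) ^ n) =O[atTop] fun n => (ρ⁻¹ : ℝ) ^ n := isBigO_refl _ _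
  have h4 : (fun n => ((ρ⁻¹ ^ n : ℝ) : ℂ)) =O[atTop] fun n => (ρ⁻¹ : ℝ) ^ n :=
    IsBigO.of_norm_left (h3.norm_left.congr_left fun n => by rw [Complex.norm_real])
  refine (h2.mul h4).congr (fun n => ?_) fun n => by rw [one_mul]
  have : (ρ : ℂ) ≠ 0 := by exact_mod_cast hρ0.ne'
  push_cast
  rw [mul_assoc, ← mul_pow, mul_inv_cancel₀ this, one_pow, mul_one]

theorem prod_one_sub_pow_mul {ζ : ℂ} {n : ℕ} (hn : 0 < n) (hζ : IsPrimitiveRoot ζ n) (y : ℂ) :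
    ∏ j ∈ Finset.range n, (1 - ζ ^ j * y) = 1 - y ^ n := by
  have h1 := hζ.pow_sub_pow_eq_prod_sub_mul 1 y hn
  rw [one_pow] at h1
  rw [h1]
  have hinj : Set.InjOn (fun j => ζ ^ j) (Finset.range n : Set ℕ) := fun i hi j hj h =>
    hζ.pow_inj (by simpa using hi) (by simpa using hj) h
  have h2 : (Finset.range n).image (fun j => ζ ^ j) = Polynomial.nthRootsFinset n (1 : ℂ) := by
    refine Finset.eq_of_subset_of_card_le ?_ ?_
    · intro z hz
      obtain ⟨j, -, rfl⟩ := Finset.mem_image.1 hz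
      rw [Polynomial.mem_nthRootsFinset hn, ← pow_mul, mul_comm, pow_mul, hζ.pow_eq_one, one_pow]
    · rw [Finset.card_image_of_injOn hinj, hζ.card_nthRootsFinset, Finset.card_range]
  rw [← h2, Finset.prod_image hinj]

/-- With `u = ζ ^ j * z`, the product over `i ≠ j` of `1 - ζ ^ i * z` is `1 + u + ⋯ + u ^ (n - 1)`:
by division where `u ≠ 1`, and by continuity at `u = 1`, where it equals `n`. This is the origin of
the factor `1 / m` in `C`. -/
theorem prod_erase_one_sub_pow_mul {ζ : ℂ} {n : ℕ} (hζ : IsPrimitiveRoot ζ n) {j : ℕ}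
    (hj : j < n) {y : ℂ} (hy : ζ ^ j * y = 1) :
    ∏ i ∈ (Finset.range n).erase j, (1 - ζ ^ i * y) = n := by
  have hn : 0 < n := by omega
  have hζ0 : ζ ^ j ≠ 0 := pow_ne_zero _ (hζ.ne_zero hn.ne')
  have key : (fun z : ℂ => ∏ i ∈ (Finset.range n).erase j, (1 - ζ ^ i * z)) =
      fun z => ∑ i ∈ Finset.range n, (ζ ^ j * z) ^ i := by
    refine Continuous.ext_on (dense_compl_singleton y) (by fun_prop) (by fun_prop) fun z hz => ?_
    have hz1 : 1 - ζ ^ j * z ≠ 0 := by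
      rw [sub_ne_zero, ← hy]
      exact fun h => hz (mul_left_cancel₀ hζ0 h).symm
    have h1 := Finset.mul_prod_erase (Finset.range n) (fun i => 1 - ζ ^ i * z) (Finset.mem_range.2 hj)
    rw [prod_one_sub_pow_mul hn hζ] at h1
    refine mul_left_cancel₀ hz1 (h1.trans ?_)
    rw [mul_neg_geom_sum, mul_pow, ← pow_mul, mul_comm j n, pow_mul, hζ.pow_eq_one, one_pow,
      one_mul]
  rw [congrFun key y]
  simp [hy]

end Peeling

/-! ### Holomorphy and splitting of the infinite products -/

section Products

open scoped Topology

/-- Bounds at radius `R` dominate the whole disc: they exclude poles there and give locally uniform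
convergence of holomorphic partial products. -/
theorem differentiableOn_tprod_one_div {ι : Type*} {a : ι → ℂ} {d : ι → ℕ} {R : ℝ}
    (hs : Summable fun i => ‖a i‖ * R ^ d i) (hlt : ∀ i, ‖a i‖ * R ^ d i < 1) :
    DifferentiableOn ℂ (fun w => ∏' i, 1 / (1 - a i * w ^ d i)) (Metric.ball 0 R) := by
  have hle (i : ι) (w : ℂ) (hw : w ∈ Metric.ball (0 : ℂ) R) : ‖a i * w ^ d i‖ ≤ ‖a i‖ * R ^ d i := by
    rw [norm_mul, norm_pow]
    have : ‖w‖ ≤ R := by simpa using (Metric.mem_ball.1 hw).le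
    gcongr
  have hne (i : ι) (w : ℂ) (hw : w ∈ Metric.ball (0 : ℂ) R) : 1 - a i * w ^ d i ≠ 0 := by
    intro h
    have h1 := (hle i w hw).trans_lt (hlt i)
    rw [← sub_eq_zero.1 h, norm_one] at h1
    exact h1.false
  have hd (i : ι) : DifferentiableOn ℂ (fun w => 1 / (1 - a i * w ^ d i)) (Metric.ball 0 R) :=
    DifferentiableOn.div (by fun_prop) (by fun_prop) (hne i)
  have h1 : ∀ᶠ i in cofinite, ‖a i‖ * R ^ d i < 1 / 2 :=
    hs.tendsto_cofinite_zero.eventually_lt_const (by norm_num)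
  have h2 : HasProdLocallyUniformlyOn (fun i w => 1 + (1 / (1 - a i * w ^ d i) - 1))
      (fun w => ∏' i, (1 + (1 / (1 - a i * w ^ d i) - 1))) (Metric.ball 0 R) := by
    refine Summable.hasProdLocallyUniformlyOn_one_add Metric.isOpen_ball (hs.mul_left 2) ?_
      fun i => (hd i).continuousOn.sub continuousOn_const
    filter_upwards [h1] with i hi w hw
    have h3 := hle i w hw
    exact (norm_one_div_one_sub_sub_one_le (h3.trans hi.le)).trans (by linarith)
  simp only [add_sub_cancel] at h2
  refine TendstoLocallyUniformlyOn.differentiableOn h2 (.of_forall fun s => ?_) Metric.isOpen_ball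
  exact DifferentiableOn.fun_finsetProd fun i _ => hd i

theorem zpow_one_sub_pnat {𝕜 : Type*} [DivisionRing 𝕜] (x : 𝕜) (j : ℕ+) :
    x ^ (1 - ((j : ℕ) : ℤ)) = (x ^ j.natPred)⁻¹ := by
  rw [← PNat.natPred_add_one j, ← zpow_natCast, ← zpow_neg]
  congr 1
  push_cast
  ring

/-- Pairs of positive integers as pairs of natural numbers. -/
def pnatProdEquiv : ℕ+ × ℕ+ ≃ ℕ × ℕ := Equiv.pnatEquivNat.prodCongr Equiv.pnatEquivNat

variable {q : ℝ}

theorem summable_F (hq : 1 < q) {x : ℝ} (hx0 : 0 ≤ x) (hx : x < 1) :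
    Summable fun k : ℕ+ × ℕ+ => ‖(q : ℂ) ^ (1 - ((k.2 : ℕ) : ℤ))‖ * x ^ (k.1 : ℕ) := by
  refine ((pnatProdEquiv.summable_iff).2 (summable_double hq hx0 hx)).congr fun k => ?_
  have : 0 < q := by linarith
  rw [zpow_one_sub_pnat, norm_inv, norm_pow, Complex.norm_real, Real.norm_of_nonneg this.le]
  simp only [Function.comp, pnatProdEquiv, Equiv.prodCongr_apply, Prod.map, Equiv.pnatEquivNat_apply]
  rw [PNat.natPred_add_one, Real.norm_of_nonneg (by positivity)]

theorem norm_F_lt (hq : 1 < q) {x : ℝ} (hx0 : 0 ≤ x) (hx : x < 1) (k : ℕ+ × ℕ+) :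
    ‖(q : ℂ) ^ (1 - ((k.2 : ℕ) : ℤ))‖ * x ^ (k.1 : ℕ) < 1 := by
  have h0 : 0 < q := by linarith
  rw [zpow_one_sub_pnat, norm_inv, norm_pow, Complex.norm_real, Real.norm_of_nonneg h0.le]
  refine mul_lt_one_of_nonneg_of_lt_one_right (inv_le_one_of_one_le₀ (one_le_pow₀ hq.le))
    (by positivity) (pow_lt_one₀ hx0 hx k.1.ne_zero)

theorem summable_norm_F (hq : 1 < q) {w : ℂ} (hw : ‖w‖ < 1) :
    Summable fun k : ℕ+ × ℕ+ => ‖(q : ℂ) ^ (1 - ((k.2 : ℕ) : ℤ)) * w ^ (k.1 : ℕ)‖ := by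
  simpa only [norm_mul, norm_pow] using summable_F hq (norm_nonneg w) hw

theorem multipliable_F (hq : 1 < q) {w : ℂ} (hw : ‖w‖ < 1) : Multipliable fun k : ℕ+ × ℕ+ =>
    1 / (1 - (q : ℂ) ^ (1 - ((k.2 : ℕ) : ℤ)) * w ^ (k.1 : ℕ)) :=
  multipliable_one_div_one_sub (summable_norm_F hq hw)

theorem factor_F_ne_zero (hq : 1 < q) {w : ℂ} (hw : ‖w‖ < 1) (k : ℕ+ × ℕ+) :
    1 - (q : ℂ) ^ (1 - ((k.2 : ℕ) : ℤ)) * w ^ (k.1 : ℕ) ≠ 0 := by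
  intro h
  have h1 := norm_F_lt hq (norm_nonneg w) hw k
  rw [← norm_pow, ← norm_mul, ← sub_eq_zero.1 h, norm_one] at h1
  exact h1.false

theorem differentiableOn_F (hq : 1 < q) {R : ℝ} (hR0 : 0 ≤ R) (hR : R < 1) :
    DifferentiableOn ℂ (F q) (Metric.ball 0 R) :=
  differentiableOn_tprod_one_div (summable_F hq hR0 hR) (norm_F_lt hq hR0 hR)

theorem F_ofReal (hq : 1 < q) {x : ℝ} (hx0 : 0 ≤ x) (hx : x < 1) :
    F q x = ((∏' k : ℕ × ℕ, 1 / (1 - (q ^ k.2)⁻¹ * x ^ (k.1 + 1)) : ℝ) : ℂ) := by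
  have h1 := (multipliable_one_div_one_sub (summable_double hq hx0 hx)).map_tprod
    Complex.ofRealHom Complex.continuous_ofReal
  simp only [Complex.ofRealHom_eq_coe] at h1
  rw [h1, ← pnatProdEquiv.tprod_eq, F]
  refine tprod_congr fun k => ?_
  rw [zpow_one_sub_pnat]
  simp only [pnatProdEquiv, Equiv.prodCongr_apply, Prod.map, Equiv.pnatEquivNat_apply]
  rw [PNat.natPred_add_one]
  push_cast
  rfl

/-- The part of the product with exponents above `M`. -/
def tailProd (q : ℝ) (M : ℕ) (w : ℂ) : ℂ := ∏' l : ℕ, 1 / (1 - (q : ℂ) * w ^ (l + M + 1))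

theorem summable_tail (q : ℝ) (M : ℕ) {x : ℝ} (hx0 : 0 ≤ x) (hx : x < 1) :
    Summable fun l : ℕ => ‖(q : ℂ)‖ * x ^ (l + M + 1) :=
  (((summable_geometric_of_lt_one hx0 hx).mul_left (x ^ (M + 1))).mul_left ‖(q : ℂ)‖).congr
    fun l => by rw [← pow_add, add_comm (M + 1), add_assoc]

theorem multipliable_tail (q : ℝ) (M : ℕ) {w : ℂ} (hw : ‖w‖ < 1) :
    Multipliable fun l : ℕ => 1 / (1 - (q : ℂ) * w ^ (l + M + 1)) :=
  multipliable_one_div_one_sub (by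
    simpa only [norm_mul, norm_pow] using summable_tail q M (norm_nonneg w) hw)

/-- The condition `q * R ^ (M + 1) < 1` keeps every pole with exponent above `M` outside the disc.
-/
theorem differentiableOn_tailProd (hq : 0 ≤ q) {M : ℕ} {R : ℝ} (hR0 : 0 ≤ R) (hR : R < 1)
    (hqR : q * R ^ (M + 1) < 1) : DifferentiableOn ℂ (tailProd q M) (Metric.ball 0 R) := by
  refine differentiableOn_tprod_one_div (summable_tail q M hR0 hR) fun l => ?_
  rw [Complex.norm_real, Real.norm_of_nonneg hq]
  refine lt_of_le_of_lt ?_ hqR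
  gcongr ?_ * ?_
  exact pow_le_pow_of_le_one hR0 hR.le (by omega)

theorem hasProd_P {q : ℝ} {m M : ℕ} (hm : m ≤ M) {w : ℂ} (hw : ‖w‖ < 1) :
    HasProd (fun l : {l : ℕ // 1 ≤ l ∧ l ≠ m} => 1 / (1 - (q : ℂ) * w ^ (l : ℕ)))
      ((∏ l ∈ (Finset.Icc 1 M).erase m, 1 / (1 - (q : ℂ) * w ^ l)) * tailProd q M w) := by
  have hinj : Function.Injective fun l : ℕ => l + M + 1 := fun a b h => by
    simpa using h
  have h1 := Finset.hasProd ((Finset.Icc 1 M).erase m) fun l => 1 / (1 - (q : ℂ) * w ^ l)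
  have h2 : HasProd ((fun l => 1 / (1 - (q : ℂ) * w ^ l)) ∘
      ((↑) : Set.range (fun l : ℕ => l + M + 1) → ℕ)) (tailProd q M w) :=
    (hinj.hasProd_range_iff (f := fun l => 1 / (1 - (q : ℂ) * w ^ l))).2
      (multipliable_tail q M hw).hasProd
  have h3 := HasProd.mul_disjoint (s := (((Finset.Icc 1 M).erase m : Finset ℕ) : Set ℕ)) (by
    rw [Set.disjoint_left]
    rintro a ha ⟨l, rfl⟩
    simp at ha) h1 h2
  have h4 : ((((Finset.Icc 1 M).erase m : Finset ℕ) : Set ℕ) ∪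
      Set.range (fun l : ℕ => l + M + 1)) = {l | 1 ≤ l ∧ l ≠ m} := by
    ext l
    simp only [Set.mem_union, Finset.mem_coe, Finset.mem_erase, Finset.mem_Icc, Set.mem_range,
      Set.mem_ofPred_eq]
    constructor
    · rintro (h | ⟨k, rfl⟩) <;> omega
    · intro h
      by_cases hl : l ≤ M
      · left; omega
      · right; exact ⟨l - (M + 1), by omega⟩
  rw [h4] at h3
  exact h3

/-- The first `M` factors, which carry the poles to be removed, are separated from a holomorphic
tail. -/
theorem tprod_ofReal_eq (M : ℕ) {x : ℝ} (hx0 : 0 ≤ x) (hx : x < 1) :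
    ((∏' e : ℕ, 1 / (1 - q * x ^ (e + 1)) : ℝ) : ℂ) =
      tailProd q M x / ∏ m ∈ Finset.Icc 1 M, (1 - (q : ℂ) * (x : ℂ) ^ m) := by
  have hm : Multipliable fun e : ℕ => 1 / (1 - q * x ^ (e + 1)) := by
    refine multipliable_one_div_one_sub ?_
    refine (summable_tail q 0 hx0 hx).congr fun e => ?_
    rw [norm_mul, norm_pow, Real.norm_of_nonneg hx0, Complex.norm_real, add_zero]
  have h1 := hm.map_tprod Complex.ofRealHom Complex.continuous_ofReal
  simp only [Complex.ofRealHom_eq_coe] at h1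
  have h2 := Multipliable.prod_mul_tprod_nat_mul' (k := M)
    (f := fun e : ℕ => 1 / (1 - (q : ℂ) * (x : ℂ) ^ (e + 1)))
    (multipliable_tail q M (by rwa [Complex.norm_real, Real.norm_of_nonneg hx0]))
  rw [h1]
  push_cast
  have h3 : ∏ m ∈ Finset.Icc 1 M, (1 - (q : ℂ) * (x : ℂ) ^ m) =
      ∏ i ∈ Finset.range M, (1 - (q : ℂ) * (x : ℂ) ^ (i + 1)) := by
    have := Finset.prod_Ico_eq_prod_range (fun m => 1 - (q : ℂ) * (x : ℂ) ^ m) 1 (M + 1)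
    rw [Finset.Ico_add_one_right_eq_Icc] at this
    simpa [add_comm 1] using this
  rw [← h2, mul_comm, h3, div_eq_mul_inv, ← Finset.prod_inv_distrib, tailProd]
  simp_rw [one_div]

end Products

/-! ### The poles -/

section Points

theorem isPrimitiveRoot_zeta {m : ℕ} (hm : m ≠ 0) : IsPrimitiveRoot (zeta m) m :=
  Complex.isPrimitiveRoot_exp m hm

/-- The absolute value of the points attached to `m`. -/
def radius (p r m : ℕ) : ℝ := (p : ℝ) ^ (-((r : ℝ) / m))

variable {p : ℕ} [hp : Fact p.Prime] {r : ℕ}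

theorem one_lt_pow_prime (hr : 1 ≤ r) : (1 : ℝ) < (p : ℝ) ^ r :=
  one_lt_pow₀ (by exact_mod_cast hp.out.one_lt) (by omega)

theorem prime_cast_pos : (0 : ℝ) < p := by exact_mod_cast hp.out.pos

theorem radius_pos (m : ℕ) : 0 < radius p r m := Real.rpow_pos_of_pos prime_cast_pos _

theorem radius_lt_one (hr : 1 ≤ r) {m : ℕ} (hm : 1 ≤ m) : radius p r m < 1 := by
  refine Real.rpow_lt_one_of_one_lt_of_neg (by exact_mod_cast hp.out.one_lt) ?_
  have : (0 : ℝ) < r := by exact_mod_cast hr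
  have : (0 : ℝ) < m := by exact_mod_cast hm
  rw [neg_lt_zero]
  positivity

theorem radius_pow {m : ℕ} (hm : 1 ≤ m) : radius p r m ^ m = ((p : ℝ) ^ r)⁻¹ := by
  have : (m : ℝ) ≠ 0 := by positivity
  rw [radius, ← Real.rpow_mul_natCast prime_cast_pos.le, neg_mul, div_mul_cancel₀ _ this,
    Real.rpow_neg prime_cast_pos.le, Real.rpow_natCast]

theorem radius_inv_pow (m n : ℕ) :
    (radius p r m)⁻¹ ^ n = (p : ℝ) ^ ((r : ℝ) * n / m) := by
  rw [radius, ← Real.rpow_neg prime_cast_pos.le, neg_neg,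
    ← Real.rpow_mul_natCast prime_cast_pos.le, div_mul_eq_mul_div]

theorem radius_strictMono (hr : 1 ≤ r) {m m' : ℕ} (hm : 1 ≤ m) (h : m < m') :
    radius p r m < radius p r m' := by
  refine Real.rpow_lt_rpow_of_exponent_lt (by exact_mod_cast hp.out.one_lt) (neg_lt_neg ?_)
  have : (0 : ℝ) < r := by exact_mod_cast hr
  have : (0 : ℝ) < m := by exact_mod_cast hm
  gcongr

theorem norm_zeta (m : ℕ) : ‖zeta m‖ = 1 := by
  rw [zeta, show 2 * (Real.pi : ℂ) * Complex.I / m = ((2 * Real.pi / m : ℝ) : ℂ) * Complex.I by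
    push_cast; ring, Complex.norm_exp_ofReal_mul_I]

theorem point_eq (m j : ℕ) : point p r m j = zeta m ^ (-(j : ℤ)) * (radius p r m : ℂ) := rfl

theorem norm_point (m j : ℕ) : ‖point p r m j‖ = radius p r m := by
  rw [point_eq, norm_mul, norm_zpow, norm_zeta, one_zpow, one_mul, Complex.norm_real,
    Real.norm_of_nonneg (radius_pos m).le]

theorem point_ne_zero (m j : ℕ) : point p r m j ≠ 0 := by
  rw [← norm_pos_iff, norm_point]
  exact radius_pos m

theorem point_inv (m j : ℕ) : (point p r m j)⁻¹ = zeta m ^ j * ((radius p r m)⁻¹ : ℝ) := by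
  rw [point_eq, mul_inv, ← zpow_neg, neg_neg, zpow_natCast]
  push_cast
  rfl

theorem point_pow {m : ℕ} (hm : 1 ≤ m) (j : ℕ) : point p r m j ^ m = ((((p : ℝ) ^ r)⁻¹ : ℝ) : ℂ) := by
  rw [point_eq, mul_pow, ← zpow_natCast (zeta m ^ (-(j : ℤ))), ← zpow_mul, mul_comm (-(j : ℤ)),
    zpow_mul, zpow_natCast, (isPrimitiveRoot_zeta (by omega)).pow_eq_one, one_zpow, one_mul,
    ← radius_pow hm]
  push_cast
  rfl

theorem point_injOn {m : ℕ} : Set.InjOn (point p r m) (Finset.range m : Set ℕ) := by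
  intro i hi j hj h
  have hi : i < m := by simpa using hi
  have hj : j < m := by simpa using hj
  have h1 := congrArg (·⁻¹) h
  simp only [point_inv] at h1
  have h2 : (((radius p r m)⁻¹ : ℝ) : ℂ) ≠ 0 := by exact_mod_cast (inv_pos.2 (radius_pos m)).ne'
  exact (isPrimitiveRoot_zeta (by omega)).pow_inj hi hj (mul_right_cancel₀ h2 h1)

/-- Absolute values suffice: if `q ρ ^ m = 1 = q ρ ^ l` with `0 < ρ < 1`, then `l = m`. -/
theorem factor_P_ne_zero (hr : 1 ≤ r) {m : ℕ} (hm : 1 ≤ m) (j : ℕ) {l : ℕ} (hl : l ≠ m) :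
    1 - (((p : ℝ) ^ r : ℝ) : ℂ) * point p r m j ^ l ≠ 0 := by
  intro h
  have hq : (0 : ℝ) < (p : ℝ) ^ r := pow_pos prime_cast_pos r
  have h1 := congrArg norm (sub_eq_zero.1 h)
  rw [norm_one, norm_mul, norm_pow, norm_point, Complex.norm_real, Real.norm_of_nonneg hq.le] at h1
  have h2 : radius p r m ^ l = radius p r m ^ m := by
    rw [radius_pow hm]
    exact eq_inv_of_mul_eq_one_right h1.symm
  exact hl (pow_right_injective₀ (radius_pos m) (radius_lt_one hr hm).ne h2)

/-- The points attached to `m`. -/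
def pointSet (p r m : ℕ) : Finset ℂ := (Finset.range m).image (point p r m)

/-- The points attached to the positive integers up to `M`. -/
def points (p r M : ℕ) : Finset ℂ := (Finset.Icc 1 M).biUnion (pointSet p r)

theorem norm_of_mem_pointSet {m : ℕ} {s : ℂ} (hs : s ∈ pointSet p r m) : ‖s‖ = radius p r m := by
  obtain ⟨j, -, rfl⟩ := Finset.mem_image.1 hs
  exact norm_point m j

theorem disjoint_pointSet (hr : 1 ≤ r) {m m' : ℕ} (hm : 1 ≤ m) (hm' : 1 ≤ m') (h : m ≠ m') :
    Disjoint (pointSet p r m) (pointSet p r m') := by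
  rw [Finset.disjoint_left]
  intro s hs hs'
  have h1 := (norm_of_mem_pointSet hs).symm.trans (norm_of_mem_pointSet hs')
  rcases lt_or_gt_of_ne h with h2 | h2
  · exact (radius_strictMono hr hm h2).ne h1
  · exact (radius_strictMono hr hm' h2).ne' h1

theorem pairwiseDisjoint_pointSet (hr : 1 ≤ r) (M : ℕ) :
    ((Finset.Icc 1 M : Finset ℕ) : Set ℕ).PairwiseDisjoint (pointSet p r) := by
  intro m hm m' hm' h
  simp only [Finset.coe_Icc, Set.mem_Icc] at hm hm'
  exact disjoint_pointSet hr hm.1 hm'.1 h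

theorem mem_points {M : ℕ} {s : ℂ} :
    s ∈ points p r M ↔ ∃ m, (1 ≤ m ∧ m ≤ M) ∧ s ∈ pointSet p r m := by
  simp [points]

theorem prod_pointSet {m : ℕ} (hm : 1 ≤ m) (w : ℂ) :
    ∏ s ∈ pointSet p r m, (1 - w / s) = 1 - (((p : ℝ) ^ r : ℝ) : ℂ) * w ^ m := by
  rw [pointSet, Finset.prod_image point_injOn]
  have h1 := prod_one_sub_pow_mul hm (isPrimitiveRoot_zeta (by omega))
    (((radius p r m)⁻¹ : ℝ) * w)
  have h2 : (((radius p r m)⁻¹ : ℝ) : ℂ) ^ m = (((p : ℝ) ^ r : ℝ) : ℂ) := by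
    rw [← Complex.ofReal_pow, inv_pow, radius_pow hm, inv_inv]
  rw [mul_pow, h2] at h1
  rw [← h1]
  refine Finset.prod_congr rfl fun j _ => ?_
  rw [div_eq_mul_inv, point_inv]
  ring

theorem prod_points (hr : 1 ≤ r) (M : ℕ) (w : ℂ) :
    ∏ s ∈ points p r M, (1 - w / s) =
      ∏ m ∈ Finset.Icc 1 M, (1 - (((p : ℝ) ^ r : ℝ) : ℂ) * w ^ m) := by
  rw [points, Finset.prod_biUnion (pairwiseDisjoint_pointSet hr M)]
  exact Finset.prod_congr rfl fun m hm => prod_pointSet (Finset.mem_Icc.1 hm).1 w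

theorem prod_erase_pointSet {m : ℕ} {s : ℂ} (hs : s ∈ pointSet p r m) :
    ∏ t ∈ (pointSet p r m).erase s, (1 - s / t) = m := by
  obtain ⟨j, hj, rfl⟩ := Finset.mem_image.1 hs
  have hj : j < m := by simpa using hj
  rw [← prod_erase_one_sub_pow_mul (isPrimitiveRoot_zeta (by omega)) hj
    (y := (((radius p r m)⁻¹ : ℝ) : ℂ) * point p r m j)
    (by rw [← mul_assoc, ← point_inv, inv_mul_cancel₀ (point_ne_zero m j)])]
  refine (Finset.prod_nbij (point p r m) ?_ ?_ ?_ ?_).symm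
  · intro i hi
    simp only [Finset.mem_erase, Finset.mem_range] at hi
    refine Finset.mem_erase.2 ⟨fun h => hi.1 (point_injOn ?_ ?_ h), Finset.mem_image_of_mem _ ?_⟩
    all_goals simp [hi, hj]
  · exact point_injOn.mono (by simp)
  · intro t ht
    obtain ⟨ht1, ht2⟩ := Finset.mem_erase.1 ht
    obtain ⟨i, hi, rfl⟩ := Finset.mem_image.1 ht2
    exact ⟨i, by simp only [Finset.coe_erase]; exact ⟨hi, fun h => ht1 (by rw [h])⟩, rfl⟩
  · intro i _
    rw [div_eq_mul_inv, point_inv]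
    ring

/-- The other roots of `1 - q w ^ m` contribute `m`; the points of each `l ≠ m` contribute their
full polynomial `1 - q s ^ l`. -/
theorem prod_erase_points (hr : 1 ≤ r) {m M : ℕ} (hm : 1 ≤ m) (hmM : m ≤ M) {s : ℂ}
    (hs : s ∈ pointSet p r m) :
    ∏ t ∈ (points p r M).erase s, (1 - s / t) =
      m * ∏ l ∈ (Finset.Icc 1 M).erase m, (1 - (((p : ℝ) ^ r : ℝ) : ℂ) * s ^ l) := by
  have hmem : m ∈ Finset.Icc 1 M := Finset.mem_Icc.2 ⟨hm, hmM⟩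
  -- Replacing the erased factor by `1` makes the product split over the disjoint union.
  have h1 (T : Finset ℂ) : ∏ t ∈ T.erase s, (1 - s / t) =
      ∏ t ∈ T, if t = s then 1 else 1 - s / t := by
    rw [← Finset.prod_erase T (a := s) (by simp)]
    exact Finset.prod_congr rfl fun t ht => (if_neg (Finset.ne_of_mem_erase ht)).symm
  rw [h1, points, Finset.prod_biUnion (pairwiseDisjoint_pointSet hr M),
    ← Finset.mul_prod_erase _ _ hmem, ← h1, prod_erase_pointSet hs]
  congr 1
  refine Finset.prod_congr rfl fun l hl => ?_
  obtain ⟨hl1, hl2⟩ := Finset.mem_erase.1 hl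
  have hl3 := (Finset.mem_Icc.1 hl2).1
  rw [← prod_pointSet hl3]
  refine Finset.prod_congr rfl fun t ht => if_neg ?_
  rintro rfl
  exact (Finset.disjoint_left.1 (disjoint_pointSet hr hl3 hm hl1)) ht hs

end Points

/-! ### The asymptotic expansion -/

section Expansion

theorem card_commuting_eq_sum_corankCount (K V : Type*) [Field K] [Finite K] [AddCommGroup V]
    [Module K V] [Module.Finite K V] :
    Nat.card {x : End K V × End K V // x.1 * x.2 = x.2 * x.1} =
      ∑ k ∈ Finset.range (finrank K V + 1), corankCount K V k := by
  have : Finite (End K V) := Module.finite_of_finite K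
  have hle (X : End K V) : finrank K X.range ≤ finrank K V := Submodule.finrank_le _
  let g : {x : End K V × End K V // x.1 * x.2 = x.2 * x.1} → Fin (finrank K V + 1) :=
    fun x => ⟨finrank K V - finrank K x.1.1.range, by omega⟩
  rw [← Nat.card_congr (Equiv.sigmaFiberEquiv g), Nat.card_sigma,
    Finset.sum_range fun k => corankCount K V k]
  refine Finset.sum_congr rfl fun k _ => ?_
  refine Nat.card_congr (((Equiv.subtypeSubtypeEquivSubtypeInter _ _).symm.trans
    (Equiv.subtypeEquivRight fun x => ?_)).symm)
  have := hle x.1.1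
  rw [Fin.ext_iff]
  change _ ↔ finrank K V - _ = _
  omega

variable {p : ℕ} [hp : Fact p.Prime] {r : ℕ}

/-- The factor `p ^ (r n²) f(n)` is the order of the general linear group. -/
theorem Q_eq_mul_totalDensity (hr : 1 ≤ r) (n : ℕ) : (Q p r n : ℝ) =
    (p : ℝ) ^ (r * n ^ 2) * f ((p : ℝ) ^ r) n * totalDensity (GaloisField p r) n := by
  have hcard : Nat.card (GaloisField p r) = p ^ r := GaloisField.card p r (by omega)
  have hq := one_lt_card (GaloisField p r)
  have h1 : Q p r n = ∑ k ∈ Finset.range (n + 1),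
      corankCount (GaloisField p r) (Fin n → GaloisField p r) k := by
    have := card_commuting_eq_sum_corankCount (GaloisField p r) (Fin n → GaloisField p r)
    rw [Module.finrank_fin_fun] at this
    rw [← this, Q]
    refine Nat.card_congr ((Matrix.toLinAlgEquiv'.toEquiv.prodCongr
      Matrix.toLinAlgEquiv'.toEquiv).subtypeEquiv fun x => ?_)
    change _ ↔ Matrix.toLinAlgEquiv' x.1 * Matrix.toLinAlgEquiv' x.2 =
      Matrix.toLinAlgEquiv' x.2 * Matrix.toLinAlgEquiv' x.1
    rw [← map_mul, ← map_mul, EmbeddingLike.apply_eq_iff_eq]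
  have h2 := indepCount_mul_f hq (le_refl n)
  have h3 : (0 : ℝ) < (Nat.card (GaloisField p r) : ℝ) ^ (n * n) * f (Nat.card (GaloisField p r)) n :=
    mul_pos (by positivity) (f_pos (by exact_mod_cast hq) n)
  have h4 : (p : ℝ) ^ (r * n ^ 2) * f ((p : ℝ) ^ r) n = indepCount (Nat.card (GaloisField p r)) n n := by
    rw [show f (Nat.card (GaloisField p r)) (n - n) = 1 by simp [f], mul_one] at h2
    rw [h2, hcard]
    push_cast
    rw [← pow_mul, sq]
  rw [← h2, show f (Nat.card (GaloisField p r)) (n - n) = 1 by simp [f], mul_one] at h3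
  rw [h4, h1, totalDensity, Finset.mul_sum]
  push_cast
  refine Finset.sum_congr rfl fun k _ => ?_
  rw [pairDensity, mul_div_cancel₀ _ h3.ne']

/-- The coefficient of the pole at `s` in the generating function. -/
def poleCoeff (p r M : ℕ) (s : ℂ) : ℂ :=
  ∑ m ∈ Finset.Icc 1 M,
    if s ∈ pointSet p r m then 1 / (m : ℂ) * (P m ((p : ℝ) ^ r) s * F ((p : ℝ) ^ r) s) else 0

theorem poleCoeff_eq (hr : 1 ≤ r) {m M : ℕ} (hm : 1 ≤ m) (hmM : m ≤ M) {s : ℂ}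
    (hs : s ∈ pointSet p r m) :
    poleCoeff p r M s = 1 / (m : ℂ) * (P m ((p : ℝ) ^ r) s * F ((p : ℝ) ^ r) s) := by
  rw [poleCoeff, Finset.sum_eq_single m, if_pos hs]
  · intro l hl hlm
    exact if_neg fun h => Finset.disjoint_left.1
      (disjoint_pointSet hr (Finset.mem_Icc.1 hl).1 hm hlm) h hs
  · exact fun h => absurd (Finset.mem_Icc.2 ⟨hm, hmM⟩) h

theorem sum_poleCoeff (hr : 1 ≤ r) (M n : ℕ) :
    ∑ s ∈ points p r M, poleCoeff p r M s * s⁻¹ ^ n =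
      ∑ m ∈ Finset.Icc 1 M, C p r m n * (((p : ℝ) ^ ((r : ℝ) * n / m) : ℝ) : ℂ) := by
  rw [points, Finset.sum_biUnion (pairwiseDisjoint_pointSet hr M)]
  refine Finset.sum_congr rfl fun m hm => ?_
  obtain ⟨hm1, hmM⟩ := Finset.mem_Icc.1 hm
  rw [pointSet, Finset.sum_image point_injOn, C, mul_assoc, Finset.sum_mul, Finset.mul_sum]
  refine Finset.sum_congr rfl fun j hj => ?_
  rw [poleCoeff_eq hr hm1 hmM (Finset.mem_image_of_mem _ hj), point_inv, mul_pow, ← pow_mul,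
    ← Complex.ofReal_pow, radius_inv_pow, mul_comm j n]
  ring

/-- A radius `R` strictly between the circles of `M` and `M + 1` encloses exactly the poles with `m
≤ M`. The error is estimated on the circle of `M` itself, so it is only as small as the last term.
-/
theorem totalDensity_isBigO (hr : 1 ≤ r) {M : ℕ} (hM : 1 ≤ M) :
    (fun n : ℕ => (totalDensity (GaloisField p r) n : ℂ) -
      ∑ m ∈ Finset.Icc 1 M, C p r m n * (((p : ℝ) ^ ((r : ℝ) * n / m) : ℝ) : ℂ))
      =O[atTop] fun n : ℕ => (p : ℝ) ^ ((r : ℝ) * n / M) := by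
  obtain ⟨R, hR1, hR2⟩ := exists_between (radius_strictMono (p := p) hr hM (Nat.lt_succ_self M))
  have hR0 : 0 < R := (radius_pos M).trans hR1
  have hRlt : R < 1 := hR2.trans (radius_lt_one hr (by omega))
  have hq := one_lt_pow_prime (p := p) hr
  have hq0 : (0 : ℝ) < (p : ℝ) ^ r := by linarith
  have hcard : (Nat.card (GaloisField p r) : ℝ) = (p : ℝ) ^ r := by
    rw [GaloisField.card p r (by omega)]
    push_cast
    rfl
  have hqR : (p : ℝ) ^ r * R ^ (M + 1) < 1 := by
    have : R ^ (M + 1) < radius p r (M + 1) ^ (M + 1) := pow_lt_pow_left₀ hR2 hR0.le (by omega)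
    rw [radius_pow (by omega)] at this
    calc (p : ℝ) ^ r * R ^ (M + 1) < (p : ℝ) ^ r * ((p : ℝ) ^ r)⁻¹ := by gcongr
      _ = 1 := mul_inv_cancel₀ hq0.ne'
  have hmain := coeff_isBigO_of_simple_poles (b := fun n => (totalDensity (GaloisField p r) n : ℂ))
    (R := R) (S := points p r M)
    (A := fun w => tailProd ((p : ℝ) ^ r) M w * F ((p : ℝ) ^ r) w) (c := poleCoeff p r M)
    (δ := ((p : ℝ) ^ r)⁻¹) (ρ := radius p r M)
    (fun s hs => by
      obtain ⟨m, ⟨hm, hmM⟩, hs⟩ := mem_points.1 hs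
      rw [mem_ball_zero_iff, norm_of_mem_pointSet hs]
      rcases hmM.eq_or_lt with rfl | h
      · exact hR1
      · exact (radius_strictMono hr hm h).trans hR1)
    (fun s hs => by
      obtain ⟨m, -, hs⟩ := mem_points.1 hs
      rw [← norm_pos_iff, norm_of_mem_pointSet hs]
      exact radius_pos m)
    ((differentiableOn_tailProd hq0.le hR0.le hRlt hqR).mul (differentiableOn_F hq hR0.le hRlt))
    -- At a pole attached to `m`, the factors of `P m` with `l ≤ M` cancel those in the erased
    -- product, and the tail matches the one in `A`.
    (fun s hs => by
      obtain ⟨m, ⟨hm, hmM⟩, hs⟩ := mem_points.1 hs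
      have hs1 : ‖s‖ < 1 := by
        rw [norm_of_mem_pointSet hs]
        exact radius_lt_one hr hm
      rw [poleCoeff_eq hr hm hmM hs, prod_erase_points hr hm hmM hs, P,
        (hasProd_P hmM hs1).tprod_eq]
      have h1 : ∏ l ∈ (Finset.Icc 1 M).erase m, (1 - (((p : ℝ) ^ r : ℝ) : ℂ) * s ^ l) ≠ 0 := by
        obtain ⟨j, -, rfl⟩ := Finset.mem_image.1 hs
        exact Finset.prod_ne_zero_iff.2 fun l hl =>
          factor_P_ne_zero hr hm j (Finset.ne_of_mem_erase hl)
      have h2 : (m : ℂ) ≠ 0 := by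
        have : m ≠ 0 := by omega
        exact_mod_cast this
      simp_rw [one_div, Finset.prod_inv_distrib]
      field_simp)
    (inv_pos.2 hq0)
    (fun x hx0 hx => by
      have hqx : (p : ℝ) ^ r * x < 1 := by
        calc (p : ℝ) ^ r * x < (p : ℝ) ^ r * ((p : ℝ) ^ r)⁻¹ := by gcongr
          _ = 1 := mul_inv_cancel₀ hq0.ne'
      have hx1 : x < 1 := hx.trans (inv_lt_one_of_one_lt₀ hq)
      have h1 := hasSum_totalDensity (GaloisField p r) hx0 (by rwa [hcard])
      rw [hcard, ← Complex.hasSum_ofReal, Complex.ofReal_mul, tprod_ofReal_eq M hx0.le hx1,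
        ← F_ofReal hq hx0.le hx1] at h1
      rw [prod_points hr, mul_div_right_comm]
      simpa only [Complex.ofReal_mul, Complex.ofReal_pow] using h1)
    (radius_pos M) hR1
  simp_rw [sum_poleCoeff hr, radius_inv_pow] at hmain
  exact hmain

theorem norm_C_le (m n : ℕ) : ‖C p r m n‖ ≤ ‖1 / (m : ℂ)‖ * ∑ j ∈ Finset.range m,
    ‖P m ((p : ℝ) ^ r) (point p r m j) * F ((p : ℝ) ^ r) (point p r m j)‖ := by
  rw [C, norm_mul]
  gcongr
  refine (norm_sum_le _ _).trans (Finset.sum_le_sum fun j _ => ?_)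
  rw [norm_mul _ (zeta m ^ (n * j)), norm_pow, norm_zeta, one_pow, mul_one]

/-- The expansion is taken to `M = N + 1`. Its last term is then absorbed into the error, as `C` is
bounded in `n` (`norm_C_le`). -/
theorem totalDensity_isBigO_next (hr : 1 ≤ r) (N : ℕ) :
    (fun n : ℕ => (totalDensity (GaloisField p r) n : ℂ) -
      ∑ m ∈ Finset.Icc 1 N, C p r m n * (((p : ℝ) ^ ((r : ℝ) * n / m) : ℝ) : ℂ))
      =O[atTop] fun n : ℕ => (p : ℝ) ^ ((r : ℝ) * n / ((N : ℝ) + 1)) := by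
  have h1 := totalDensity_isBigO (p := p) hr (M := N + 1) (by omega)
  have h2 : (fun n : ℕ => C p r (N + 1) n * (((p : ℝ) ^ ((r : ℝ) * n / ((N : ℝ) + 1)) : ℝ) : ℂ))
      =O[atTop] fun n : ℕ => (p : ℝ) ^ ((r : ℝ) * n / ((N : ℝ) + 1)) := by
    refine IsBigO.of_bound (‖1 / ((N + 1 : ℕ) : ℂ)‖ * ∑ j ∈ Finset.range (N + 1),
      ‖P (N + 1) ((p : ℝ) ^ r) (point p r (N + 1) j) *
        F ((p : ℝ) ^ r) (point p r (N + 1) j)‖) (.of_forall fun n => ?_)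
    rw [norm_mul, Complex.norm_real]
    exact mul_le_mul_of_nonneg_right (norm_C_le _ n) (norm_nonneg _)
  push_cast at h1
  refine (h1.add h2).congr_left fun n => ?_
  rw [Finset.sum_Icc_succ_top (by omega)]
  push_cast
  ring

theorem Q_sub_truncated_isBigO (hr : 1 ≤ r) (N : ℕ) :
    (fun n : ℕ => (Q p r n : ℂ) - truncated p r N n) =O[atTop] fun n : ℕ =>
      (p : ℝ) ^ (r * n ^ 2) * f ((p : ℝ) ^ r) n * (p : ℝ) ^ ((r : ℝ) * n / ((N : ℝ) + 1)) := by
  have h1 : (fun n : ℕ => (((p : ℝ) ^ (r * n ^ 2) * f ((p : ℝ) ^ r) n : ℝ) : ℂ)) =O[atTop]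
      fun n : ℕ => (p : ℝ) ^ (r * n ^ 2) * f ((p : ℝ) ^ r) n :=
    .of_norm_le fun n => by
      rw [Complex.norm_real, Real.norm_of_nonneg
        (mul_nonneg (by positivity) (f_pos (one_lt_pow_prime hr) n).le)]
  refine (h1.mul (totalDensity_isBigO_next hr N)).congr_left fun n => ?_
  have h2 := congrArg (Complex.ofReal) (Q_eq_mul_totalDensity (p := p) hr n)
  rw [Complex.ofReal_natCast] at h2
  rw [h2, truncated]
  push_cast
  ring

theorem f_le_one {q : ℝ} (hq : 1 < q) (n : ℕ) : f q n ≤ 1 := by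
  refine Finset.prod_le_one (fun j hj => ?_) fun j hj => ?_
  all_goals rw [zpow_neg, zpow_natCast]
  · exact sub_nonneg.2 (inv_le_one_of_one_le₀ (one_le_pow₀ hq.le))
  · have : 0 < q := by linarith
    exact sub_le_self _ (by positivity)

theorem Q_sub_truncated_isBigO_eps (hr : 1 ≤ r) (N : ℕ) {ε : ℝ} (hε : 0 < ε) :
    (fun n : ℕ => (Q p r n : ℂ) - truncated p r N n) =O[atTop] fun n : ℕ =>
      (p : ℝ) ^ ((r : ℝ) * (n : ℝ) ^ 2 + ((r : ℝ) / ((N : ℝ) + 1) + ε) * n) := by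
  refine (Q_sub_truncated_isBigO hr N).trans (.of_norm_le fun n => ?_)
  have hp0 : (0 : ℝ) < p := prime_cast_pos
  have hp1 : (1 : ℝ) ≤ p := by exact_mod_cast hp.out.one_lt.le
  have hf0 := (f_pos (one_lt_pow_prime (p := p) hr) n).le
  have hf1 := f_le_one (one_lt_pow_prime (p := p) hr) n
  rw [Real.norm_of_nonneg (by positivity)]
  calc (p : ℝ) ^ (r * n ^ 2) * f ((p : ℝ) ^ r) n * (p : ℝ) ^ ((r : ℝ) * n / ((N : ℝ) + 1))
      ≤ (p : ℝ) ^ (r * n ^ 2) * 1 * (p : ℝ) ^ ((r : ℝ) * n / ((N : ℝ) + 1)) := by gcongr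
    _ = (p : ℝ) ^ ((r : ℝ) * (n : ℝ) ^ 2 + (r : ℝ) * n / ((N : ℝ) + 1)) := by
      rw [mul_one, Real.rpow_add hp0, ← Real.rpow_natCast]
      push_cast
      rfl
    _ ≤ _ := by
      refine Real.rpow_le_rpow_of_exponent_le hp1 ?_
      have : 0 ≤ ε * n := by positivity
      rw [add_mul, div_mul_eq_mul_div]
      linarith

end Expansion

/-! ### The leading term -/

section Leading

open scoped Topology

variable {q : ℝ}

theorem f_mul_prod (hq : 1 < q) (n : ℕ) :
    f q n * ∏ k ∈ Finset.range n, 1 / (1 - (q ^ (k + 1))⁻¹) = 1 := by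
  induction n with
  | zero => simp [f]
  | succ n ih =>
    have h : 1 - (q ^ (n + 1))⁻¹ ≠ 0 :=
      (sub_pos.2 (inv_lt_one_of_one_lt₀ (one_lt_pow₀ hq (by omega)))).ne'
    rw [f_succ, Finset.prod_range_succ, mul_mul_mul_comm, ih, mul_one_div_cancel h, mul_one]

theorem multipliable_inv_pow (hq : 1 < q) : Multipliable fun k : ℕ => 1 / (1 - (q ^ (k + 1))⁻¹) := by
  have h0 : 0 < q := by linarith
  refine multipliable_one_div_one_sub ?_
  refine ((summable_geometric_of_lt_one (inv_nonneg.2 h0.le)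
    (inv_lt_one_of_one_lt₀ hq)).mul_left q⁻¹).congr fun k => ?_
  rw [Real.norm_of_nonneg (by positivity), pow_succ', mul_inv, inv_pow]

theorem tendsto_f (hq : 1 < q) :
    Tendsto (f q) atTop (𝓝 (∏' k : ℕ, 1 / (1 - (q ^ (k + 1))⁻¹))⁻¹) := by
  have h1 := (multipliable_inv_pow hq).hasProd.tendsto_prod_nat
  have h2 : 1 ≤ ∏' k : ℕ, 1 / (1 - (q ^ (k + 1))⁻¹) :=
    ge_of_tendsto' h1 fun L => Finset.prod_induction _ (1 ≤ ·)
      (fun _ _ => one_le_mul_of_one_le_of_one_le) le_rfl fun j _ =>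
        one_le_one_div_one_sub (by positivity) (inv_lt_one_of_one_lt₀ (one_lt_pow₀ hq (by omega)))
  refine (h1.inv₀ (by linarith)).congr fun n => ?_
  exact (eq_inv_of_mul_eq_one_left (f_mul_prod hq n)).symm

/-- `f q n` decreases and `f q n - q ^ (-n)` increases to the same limit, the inverse of the
product; the second monotonicity uses `q ≥ 2 ≥ 1 + f q n`. -/
theorem abs_f_mul_tprod_sub_one_le (hq : 2 ≤ q) (n : ℕ) :
    |f q n * (∏' k : ℕ, 1 / (1 - (q ^ (k + 1))⁻¹)) - 1| ≤
      |∏' k : ℕ, 1 / (1 - (q ^ (k + 1))⁻¹)| * (q ^ n)⁻¹ := by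
  have hq1 : 1 < q := by linarith
  have hlim := tendsto_f hq1
  have hanti : Antitone (f q) := antitone_nat_of_succ_le fun n => by
    rw [f_succ]
    refine mul_le_of_le_one_right (f_pos hq1 n).le (sub_le_self _ (by positivity))
  have hmono : Monotone fun n => f q n - (q ^ n)⁻¹ := monotone_nat_of_le_succ fun n => by
    have h1 := f_le_one hq1 n
    have h2 : (q ^ n)⁻¹ = q * (q ^ (n + 1))⁻¹ := by rw [pow_succ]; field_simp
    have h3 : 0 < (q ^ (n + 1))⁻¹ := by positivity
    rw [f_succ, h2]
    nlinarith
  have hlim2 : Tendsto (fun n => f q n - (q ^ n)⁻¹) atTop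
      (𝓝 ((∏' k : ℕ, 1 / (1 - (q ^ (k + 1))⁻¹))⁻¹ - 0)) :=
    hlim.sub (tendsto_pow_atTop_atTop_of_one_lt hq1).inv_tendsto_atTop
  have h1 := hanti.le_of_tendsto hlim n
  have h2 := hmono.ge_of_tendsto hlim2 n
  set T := ∏' k : ℕ, 1 / (1 - (q ^ (k + 1))⁻¹)
  -- If `T` were `0`, the products `f q n * ∏ ...`, all equal to `1`, would tend to `T⁻¹ * T = 0`.
  rcases eq_or_ne T 0 with h0 | h0
  · exfalso
    have h3 : Tendsto (fun n => f q n * ∏ k ∈ Finset.range n, 1 / (1 - (q ^ (k + 1))⁻¹)) atTop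
        (𝓝 (T⁻¹ * T)) := hlim.mul (multipliable_inv_pow hq1).hasProd.tendsto_prod_nat
    simp_rw [f_mul_prod hq1, h0, mul_zero] at h3
    exact one_ne_zero (tendsto_nhds_unique tendsto_const_nhds h3)
  · rw [show f q n * T - 1 = T * (f q n - T⁻¹) by field_simp, abs_mul]
    gcongr
    rw [abs_of_nonneg (by linarith)]
    linarith

/-- Along the antidiagonal of sum `n` all `n + 1` factors equal `1 / (1 - q ^ (-(n + 1)))`. -/
theorem hasProd_leading (hq : 1 < q) :
    HasProd (fun j : ℕ+ => (1 / (1 - (q ^ (j : ℕ))⁻¹)) ^ (j : ℕ))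
      (∏' k : ℕ × ℕ, 1 / (1 - (q ^ k.2)⁻¹ * q⁻¹ ^ (k.1 + 1))) := by
  have h0 : 0 < q := by linarith
  have h1 := (multipliable_one_div_one_sub (summable_double hq (inv_nonneg.2 h0.le)
    (inv_lt_one_of_one_lt₀ hq))).hasProd
  rw [← Finset.HasAntidiagonal.sigmaAntidiagonalEquivProd.hasProd_iff] at h1
  have h2 := h1.sigma (g := fun n => (1 / (1 - (q ^ (n + 1))⁻¹)) ^ (n + 1)) fun n => by
    have h3 := hasProd_fintype (fun c : Finset.HasAntidiagonal.antidiagonal n =>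
      1 / (1 - (q ^ (c : ℕ × ℕ).2)⁻¹ * q⁻¹ ^ ((c : ℕ × ℕ).1 + 1)))
    have h4 : ∏ c : Finset.HasAntidiagonal.antidiagonal n,
        1 / (1 - (q ^ (c : ℕ × ℕ).2)⁻¹ * q⁻¹ ^ ((c : ℕ × ℕ).1 + 1)) =
        (1 / (1 - (q ^ (n + 1))⁻¹)) ^ (n + 1) := by
      rw [Finset.prod_coe_sort (Finset.HasAntidiagonal.antidiagonal n)
        (fun c : ℕ × ℕ => 1 / (1 - (q ^ c.2)⁻¹ * q⁻¹ ^ (c.1 + 1))), ← Finset.Nat.card_antidiagonal n]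
      refine Finset.prod_eq_pow_card fun c hc => ?_
      rw [inv_pow, ← mul_inv, ← pow_add, Finset.Nat.card_antidiagonal,
        ← Finset.HasAntidiagonal.mem_antidiagonal.1 hc]
      congr 4
      ring
    rw [← h4]
    exact h3
  rw [← Equiv.pnatEquivNat.hasProd_iff] at h2
  refine h2.congr_fun ?_ |> id
  intro j
  simp only [Function.comp, Equiv.pnatEquivNat_apply]
  rw [PNat.natPred_add_one]

/-- At `w = q⁻¹` the factor with `l ≥ 2` has `q w ^ l = q ^ (-(l - 1))`, so `P 1` is the inverse of
the limit of `f`. -/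
theorem P_one_inv (hq : 1 < q) :
    P 1 q ((q⁻¹ : ℝ) : ℂ) = ((∏' k : ℕ, 1 / (1 - (q ^ (k + 1))⁻¹) : ℝ) : ℂ) := by
  have h0 : 0 < q := by linarith
  have h1 : ‖((q⁻¹ : ℝ) : ℂ)‖ < 1 := by
    rw [Complex.norm_real, Real.norm_of_nonneg (inv_nonneg.2 h0.le)]
    exact inv_lt_one_of_one_lt₀ hq
  have h2 := (multipliable_inv_pow hq).map_tprod Complex.ofRealHom Complex.continuous_ofReal
  simp only [Complex.ofRealHom_eq_coe] at h2
  rw [P, (hasProd_P le_rfl h1).tprod_eq, h2]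
  simp only [Finset.Icc_self, Finset.erase_singleton, Finset.prod_empty, one_mul, tailProd]
  refine tprod_congr fun k => ?_
  push_cast
  have : (q : ℂ) ≠ 0 := by exact_mod_cast h0.ne'
  rw [show k + 1 + 1 = (k + 1) + 1 from rfl, pow_succ' _ (k + 1), mul_inv_cancel_left₀ this, inv_pow]

variable {p : ℕ} [hp : Fact p.Prime] {r : ℕ}

theorem leading_factor_eq (j : ℕ+) :
    (1 - (p : ℝ) ^ (-((r : ℤ) * ((j : ℕ) : ℤ)))) ^ (-((j : ℕ) : ℤ)) =
      (1 / (1 - (((p : ℝ) ^ r) ^ (j : ℕ))⁻¹)) ^ (j : ℕ) := by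
  rw [zpow_neg, zpow_neg, zpow_natCast, one_div, inv_pow, zpow_mul, zpow_natCast, zpow_natCast]

theorem hasProd_leading_factor (hr : 1 ≤ r) :
    HasProd (fun j : ℕ+ => (1 - (p : ℝ) ^ (-((r : ℤ) * ((j : ℕ) : ℤ)))) ^ (-((j : ℕ) : ℤ)))
      (∏' k : ℕ × ℕ, 1 / (1 - (((p : ℝ) ^ r) ^ k.2)⁻¹ * ((p : ℝ) ^ r)⁻¹ ^ (k.1 + 1))) := by
  simp_rw [leading_factor_eq]
  exact hasProd_leading (one_lt_pow_prime hr)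

theorem C_one (hr : 1 ≤ r) (n : ℕ) : C p r 1 n =
    (((∏' k : ℕ, 1 / (1 - (((p : ℝ) ^ r) ^ (k + 1))⁻¹)) *
      ∏' j : ℕ+, (1 - (p : ℝ) ^ (-((r : ℤ) * ((j : ℕ) : ℤ)))) ^ (-((j : ℕ) : ℤ)) : ℝ) : ℂ) := by
  have hq := one_lt_pow_prime (p := p) hr
  have h1 : point p r 1 0 = ((((p : ℝ) ^ r)⁻¹ : ℝ) : ℂ) := by
    rw [← point_pow le_rfl 0, pow_one]
  rw [(hasProd_leading_factor hr).tprod_eq, C, Finset.sum_range_one, h1, P_one_inv hq,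
    F_ofReal hq (by positivity) (inv_lt_one_of_one_lt₀ hq)]
  push_cast
  simp

/-- The expansion with `N = 1` has the stated error. Replacing `f(n) C_1` by its limit costs a
relative `q ^ (-n)`, hence only `O(q ^ (n²))` in absolute terms. -/
theorem Q_sub_leading_isBigO (hr : 1 ≤ r) :
    (fun n : ℕ => (Q p r n : ℝ) - (p : ℝ) ^ (r * (n ^ 2 + n)) *
        ∏' j : ℕ+, (1 - (p : ℝ) ^ (-((r : ℤ) * ((j : ℕ) : ℤ)))) ^ (-((j : ℕ) : ℤ)))
      =O[atTop] fun n : ℕ => (p : ℝ) ^ ((r : ℝ) * (n : ℝ) ^ 2 + (r : ℝ) * n / 2) := by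
  have hp0 : (0 : ℝ) < p := prime_cast_pos
  have hp1 : (1 : ℝ) ≤ p := by exact_mod_cast hp.out.one_lt.le
  have hq := one_lt_pow_prime (p := p) hr
  have hq2 : (2 : ℝ) ≤ (p : ℝ) ^ r := by
    have h1 : (2 : ℝ) ≤ p := by exact_mod_cast hp.out.two_le
    exact h1.trans (le_self_pow₀ hp1 (by omega))
  set U := ∏' j : ℕ+, (1 - (p : ℝ) ^ (-((r : ℤ) * ((j : ℕ) : ℤ)))) ^ (-((j : ℕ) : ℤ)) with hU
  set T := ∏' k : ℕ, 1 / (1 - (((p : ℝ) ^ r) ^ (k + 1))⁻¹) with hT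
  have hscale (n : ℕ) : (p : ℝ) ^ (r * n ^ 2) * (p : ℝ) ^ ((r : ℝ) * n / 2) =
      (p : ℝ) ^ ((r : ℝ) * (n : ℝ) ^ 2 + (r : ℝ) * n / 2) := by
    rw [Real.rpow_add hp0, ← Real.rpow_natCast]
    push_cast
    rfl
  have h1 : (fun n : ℕ => (Q p r n : ℂ) - truncated p r 1 n) =O[atTop] fun n : ℕ =>
      (p : ℝ) ^ ((r : ℝ) * (n : ℝ) ^ 2 + (r : ℝ) * n / 2) := by
    refine (Q_sub_truncated_isBigO hr 1).trans (.of_norm_le fun n => ?_)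
    have hf0 := (f_pos hq n).le
    have hf1 := f_le_one hq n
    rw [Real.norm_of_nonneg (by positivity), ← hscale]
    push_cast
    rw [one_add_one_eq_two]
    gcongr
    exact mul_le_of_le_one_right (by positivity) hf1
  have htr (n : ℕ) : truncated p r 1 n = (((p : ℝ) ^ (r * (n ^ 2 + n)) * U *
      (f ((p : ℝ) ^ r) n * T) : ℝ) : ℂ) := by
    rw [truncated, Finset.Icc_self, Finset.sum_singleton, C_one hr, ← hU, ← hT, Nat.cast_one, div_one,
      ← Nat.cast_mul, Real.rpow_natCast, mul_add, pow_add]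
    push_cast
    ring
  have h2 : (fun n : ℕ => truncated p r 1 n - (((p : ℝ) ^ (r * (n ^ 2 + n)) * U : ℝ) : ℂ))
      =O[atTop] fun n : ℕ => (p : ℝ) ^ ((r : ℝ) * (n : ℝ) ^ 2 + (r : ℝ) * n / 2) := by
    refine IsBigO.of_bound (|U| * |T|) (.of_forall fun n => ?_)
    rw [htr, ← Complex.ofReal_sub, Complex.norm_real, ← mul_sub_one, norm_mul, norm_mul,
      Real.norm_of_nonneg (pow_nonneg hp0.le _), ← hscale,
      Real.norm_of_nonneg (r := _ * _) (by positivity)]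
    have h3 := abs_f_mul_tprod_sub_one_le hq2 n
    have h4 : (1 : ℝ) ≤ (p : ℝ) ^ ((r : ℝ) * n / 2) := Real.one_le_rpow hp1 (by positivity)
    calc (p : ℝ) ^ (r * (n ^ 2 + n)) * ‖U‖ * ‖f ((p : ℝ) ^ r) n * T - 1‖
        ≤ (p : ℝ) ^ (r * (n ^ 2 + n)) * |U| * (|T| * (((p : ℝ) ^ r) ^ n)⁻¹) := by
          gcongr
          · exact le_rfl
          · exact h3
      _ = |U| * |T| * ((p : ℝ) ^ (r * n ^ 2) * 1) := by
          rw [mul_add, pow_add, pow_mul (p : ℝ) r n]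
          field_simp
      _ ≤ |U| * |T| * ((p : ℝ) ^ (r * n ^ 2) * (p : ℝ) ^ ((r : ℝ) * n / 2)) := by gcongr
  refine IsBigO.of_norm_left ((h1.add h2).norm_left.congr_left fun n => ?_)
  rw [sub_add_sub_cancel, ← Complex.ofReal_natCast, ← Complex.ofReal_sub, Complex.norm_real]

end Leading

end CommutingPairs

end

theorem theorem2 (p : ℕ) [Fact p.Prime] (r : ℕ) (hr : 1 ≤ r) :
    (∀ m : ℕ, 1 ≤ m → ∀ j < m,
      ‖CommutingPairs.point p r m j‖ < 1 ∧
      (∀ l : ℕ, 1 ≤ l → l ≠ m →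
        1 - (((p : ℝ) ^ r : ℝ) : ℂ) * CommutingPairs.point p r m j ^ l ≠ 0) ∧
      Multipliable (fun l : {l : ℕ // 1 ≤ l ∧ l ≠ m} =>
        1 / (1 - (((p : ℝ) ^ r : ℝ) : ℂ) * CommutingPairs.point p r m j ^ (l : ℕ))) ∧
      (∀ k : ℕ+ × ℕ+,
        1 - (((p : ℝ) ^ r : ℝ) : ℂ) ^ (1 - ((k.2 : ℕ) : ℤ)) *
          CommutingPairs.point p r m j ^ (k.1 : ℕ) ≠ 0) ∧
      Multipliable (fun k : ℕ+ × ℕ+ =>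
        1 / (1 - (((p : ℝ) ^ r : ℝ) : ℂ) ^ (1 - ((k.2 : ℕ) : ℤ)) *
          CommutingPairs.point p r m j ^ (k.1 : ℕ)))) ∧
    (∀ N : ℕ,
      (fun n : ℕ => (CommutingPairs.Q p r n : ℂ) - CommutingPairs.truncated p r N n)
        =O[atTop] fun n : ℕ => (p : ℝ) ^ (r * n ^ 2) * CommutingPairs.f ((p : ℝ) ^ r) n *
          (p : ℝ) ^ ((r : ℝ) * n / ((N : ℝ) + 1))) ∧
    (∀ N : ℕ, ∀ ε : ℝ, 0 < ε →
      (fun n : ℕ => (CommutingPairs.Q p r n : ℂ) - CommutingPairs.truncated p r N n)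
        =O[atTop] fun n : ℕ =>
          (p : ℝ) ^ ((r : ℝ) * (n : ℝ) ^ 2 + ((r : ℝ) / ((N : ℝ) + 1) + ε) * n)) ∧
    Multipliable (fun j : ℕ+ =>
      (1 - (p : ℝ) ^ (-((r : ℤ) * ((j : ℕ) : ℤ)))) ^ (-((j : ℕ) : ℤ))) ∧
    (fun n : ℕ => (CommutingPairs.Q p r n : ℝ) -
        (p : ℝ) ^ (r * (n ^ 2 + n)) *
          ∏' j : ℕ+, (1 - (p : ℝ) ^ (-((r : ℤ) * ((j : ℕ) : ℤ)))) ^ (-((j : ℕ) : ℤ)))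
      =O[atTop] fun n : ℕ => (p : ℝ) ^ ((r : ℝ) * (n : ℝ) ^ 2 + (r : ℝ) * n / 2) := by
  have hq := CommutingPairs.one_lt_pow_prime (p := p) hr
  refine ⟨fun m hm j hj => ?_, fun N => CommutingPairs.Q_sub_truncated_isBigO hr N,
    fun N ε hε => CommutingPairs.Q_sub_truncated_isBigO_eps hr N hε,
    (CommutingPairs.hasProd_leading_factor hr).multipliable,
    CommutingPairs.Q_sub_leading_isBigO hr⟩
  have h1 : ‖CommutingPairs.point p r m j‖ < 1 := by
    rw [CommutingPairs.norm_point]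
    exact CommutingPairs.radius_lt_one hr hm
  exact ⟨h1, fun l _ hl => CommutingPairs.factor_P_ne_zero hr hm j hl,
    (CommutingPairs.hasProd_P le_rfl h1).multipliable, CommutingPairs.factor_F_ne_zero hq h1,
    CommutingPairs.multipliable_F hq h1⟩
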